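/- Let $n\ge1$, $s\in(0,1)$, $\alpha\in(0,s)$, $0<\lambda\le\Lambda$, and let $\Omega\subset\mathbb R^n$ be a bounded $C^{1,\alpha}$ domain, i.e. a bounded open set (connectedness is not needed) which, in a ball of fixed radius around each boundary point and after a rotation, is the epigraph of a $C^{1,\alpha}$ function. Let $d(x)=\operatorname{dist}(x,\mathbb R^n\setminus\Omega)$. For measurable $a:S^{n-1}\to\mathbb R$ with $\lambda\le a(\theta)\le\Lambda$ for all $\theta\in S^{n-1}$, set $$Lu(x)=\int_{\mathbb R^n}\left(\frac{u(x+y)+u(x-y)}{2}-u(x)\right)\frac{a(y/|y|)}{|y|^{n+2s}}\,dy .$$ Let $C_0>0$ and let $\psi:\mathbb R^n\to\mathbb R$ be a regularized distance of $\Omega$ with constant $C_0$, i.e. $\psi\in C^2(\Omega)$ and $$C_0^{-1}d\le\psi\le C_0d\ \text{ in }\mathbb R^n,\qquad \|\psi\|_{C^{1,\alpha}(\overline\Omega)}\le C_0,\qquad |D^2\psi|\le C_0d^{\alpha-1}\ \text{ in }\Omega .$$ Then, for every $x\in\Omega$, the integral defining $L(\psi^s)(x)$ converges absolutely, and $$|L(\psi^s)(x)|\le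 C\,d(x)^{\alpha-s},$$ where the constant $C$ depends only on $n$, $s$, $\alpha$, $\Omega$, $\lambda$, $\Lambda$ and $C_0$ (and not on $x$, on $a$, or otherwise on $\psi$). -/

import Mathlib

open MeasureTheory
open scoped ENNReal

noncomputable section

namespace StableBarrier

/-- Euclidean space `ℝⁿ`. -/
abbrev RR (n : ℕ) : Type := EuclideanSpace ℝ (Fin n)

/-- `d(x) = dist(x, ℝⁿ \ Ω)`. -/
def bdist {n : ℕ} (Ω : Set (RR n)) (x : RR n) : ℝ := Metric.infDist x Ωᶜ

/-- A `C^{1,α}` open set (not necessarily connected): there are `r > 0` and `K` such that for every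
boundary point `z`, in the ball `B_r(z)` and in the coordinates given by a unit vector `e` and the
hyperplane orthogonal to `e`, the set `Ω` is the strict epigraph of a `C^1` function `γ` whose
derivative is `α`-Hölder with constant `K`. Only the values of `γ` on the hyperplane enter, since
`x - ⟪e, x⟫ e` is the orthogonal projection of `x` onto it. For bounded `Ω`, compactness of the
boundary makes this the same as letting `r` and `K` depend on `z`. -/
def IsC1HolderDomain {n : ℕ} (α : ℝ) (Ω : Set (RR n)) : Prop :=
  IsOpen Ω ∧ ∃ r > 0, ∃ K : ℝ, ∀ z ∈ frontier Ω,
    ∃ (e : RR n) (γ : RR n → ℝ), ‖e‖ = 1 ∧ ContDiff ℝ 1 γ ∧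
      (∀ u v, ‖fderiv ℝ γ u - fderiv ℝ γ v‖ ≤ K * ‖u - v‖ ^ α) ∧
      ∀ x ∈ Metric.ball z r, x ∈ Ω ↔ γ (x - inner ℝ e x • e) < inner ℝ e x

/-- The `C^{1,α}` norm `sup |u| + sup |∇u| + [∇u]_α` of a function that is `C^1` in the open set
`Ω`. The suprema over `Ω` agree with those over its closure when `u` and `∇u` extend
continuously, which finiteness of the last term guarantees for `∇u`. -/
def c1HolderNorm {n : ℕ} (α : ℝ) (Ω : Set (RR n)) (u : RR n → ℝ) : ℝ≥0∞ :=
  (⨆ x ∈ Ω, ‖u x‖ₑ) + (⨆ x ∈ Ω, ‖fderiv ℝ u x‖ₑ) +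
    ⨆ x ∈ Ω, ⨆ y ∈ Ω, ⨆ _ : x ≠ y,
      ENNReal.ofReal (‖fderiv ℝ u x - fderiv ℝ u y‖ / ‖x - y‖ ^ α)

/-- `ψ` is a regularized distance of `Ω` with constant `C`. The first pair of inequalities holds in
all of `ℝⁿ`, so `ψ` vanishes outside `Ω`. -/
structure IsRegularizedDistance {n : ℕ} (α C : ℝ) (Ω : Set (RR n)) (ψ : RR n → ℝ) : Prop where
  const_pos : 0 < C
  lower : ∀ x, C⁻¹ * bdist Ω x ≤ ψ x
  upper : ∀ x, ψ x ≤ C * bdist Ω x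
  contDiffOn : ContDiffOn ℝ 2 ψ Ω
  norm_le : c1HolderNorm α Ω ψ ≤ ENNReal.ofReal C
  hessian_le : ∀ x ∈ Ω, ‖iteratedFDeriv ℝ 2 ψ x‖ ≤ C * bdist Ω x ^ (α - 1)

/-- The angular density `a` is measurable and satisfies `lam ≤ a ≤ Lam` on the unit sphere; its
values off the sphere are irrelevant. -/
structure IsEllipticDensity {n : ℕ} (lam Lam : ℝ) (a : RR n → ℝ) : Prop where
  measurable : Measurable fun θ : Metric.sphere (0 : RR n) 1 => a θ
  lower : ∀ θ : RR n, ‖θ‖ = 1 → lam ≤ a θ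
  upper : ∀ θ : RR n, ‖θ‖ = 1 → a θ ≤ Lam

/-- The integrand of `L u (x)`. -/
def opIntegrand {n : ℕ} (s : ℝ) (a : RR n → ℝ) (u : RR n → ℝ) (x y : RR n) : ℝ :=
  ((u (x + y) + u (x - y)) / 2 - u x) * (a (‖y‖⁻¹ • y) / ‖y‖ ^ ((n : ℝ) + 2 * s))

/-- `L u (x) = ∫ ((u(x+y) + u(x-y))/2 - u(x)) a(y/|y|) / |y|^{n+2s} dy`. -/
def op {n : ℕ} (s : ℝ) (a : RR n → ℝ) (u : RR n → ℝ) (x : RR n) : ℝ :=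
  ∫ y, opIntegrand s a u x y

end StableBarrier

end

/-! Fix `x` in Ω, put `ρ = bdist Ω x`, and let ℓ be the first order Taylor polynomial of ψ at `x`.
The function `ℓ₊ ^ s` depends on one linear variable. In polar coordinates every stable operator
applied to it at a point where ℓ > 0 becomes a superposition of one-dimensional fractional
Laplacians of `t ↦ t₊ ^ s`, and these vanish, whatever the angular density
(`integral_powSecondDiff_eq_zero`, `IsEllipticDensity.integral_powSecondDiff_mul_kernel`). Hence
only the error `w(y) = ψ(x + y) ^ s - ℓ₊(x + y) ^ s` contributes. It suffices to bound the integral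
of `|w(y)| |y| ^ (-n - 2s)` by a multiple of `ρ ^ (α - s)`
(`exists_lintegral_linearizationError_le`).

For `|y| < ρ / 2` the Hessian bound gives `|w| ≲ ρ ^ (α + s - 2) |y| ^ 2`, which integrates to `ρ ^
(α - s)`. For `|y|` above a fixed radius, `|w| ≲ |y| ^ s` suffices. When ρ is small, the
intermediate range carries the difficulty. There `ψ - ℓ = O(|y| ^ (1 + α))` inside Ω and `ℓ ≤ O(|y|
^ (1 + α))` outside, so `|w| ≲ |y| ^ (1 + α) (f₊ ^ (s - 1) + ℓ₊ ^ (s - 1))`, with `f` a Lipschitz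
defining function of Ω (`IsRegularizedDistance.abs_linearizationError_le_of_chart`).

The negative powers are singular on hypersurfaces, but both `f` and ℓ grow at unit speed along a
vector of controlled length. For ℓ this is the nondegeneracy of the gradient near the boundary
(`IsRegularizedDistance.exists_fderiv_eq_one`). Such a power has integral at most a multiple of `r ^
(n + s - 1)` over balls of radius `r` (`setLIntegral_ball_max_rpow_le`), and the layer cake formula
then yields `ρ ^ (α - s)` because `α < s`. -/

/-! ### The one-dimensional identity for `t₊ ^ s`. -/

open Set Filter Topology in
-- The integrand is the derivative of `((1 + t) ^ s - 1) ^ 2 * t ^ (-2 * s) / (2 * s)`, whose limit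
-- at infinity is `1 / (2 * s)`. Integrability is free because the first factor equals `((1 + t) ^ s
-- - 1) * (1 - (1 + t) ^ (s - 1)) ≥ 0`.
theorem integral_Ioi_add_rpow_telescoping {s ε : ℝ} (hs : 0 < s) (hs1 : s < 1) (hε : 0 < ε) :
    IntegrableOn (fun t : ℝ => ((1 + t) ^ s - 1 + ((1 + t) ^ (s - 1) - (1 + t) ^ (2 * s - 1)))
      * t ^ (-1 - 2 * s)) (Ioi ε) ∧
    ∫ t in Ioi ε, ((1 + t) ^ s - 1 + ((1 + t) ^ (s - 1) - (1 + t) ^ (2 * s - 1)))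
      * t ^ (-1 - 2 * s) = 1 / (2 * s) - ((1 + ε) ^ s - 1) ^ 2 * ε ^ (-2 * s) / (2 * s) := by
  have hder : ∀ t ∈ Ici ε, HasDerivAt
      (fun t : ℝ => ((1 + t) ^ s - 1) ^ 2 * t ^ (-2 * s) / (2 * s))
      (((1 + t) ^ s - 1 + ((1 + t) ^ (s - 1) - (1 + t) ^ (2 * s - 1))) * t ^ (-1 - 2 * s)) t := by
    intro t ht
    have ht0 : 0 < t := hε.trans_le ht
    have h1 : HasDerivAt (fun t : ℝ => (1 + t) ^ s) (1 * s * (1 + t) ^ (s - 1)) t :=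
      ((hasDerivAt_id t).const_add 1).rpow_const (Or.inl (by simp; positivity))
    have h2 : HasDerivAt (fun t : ℝ => t ^ (-2 * s)) (1 * (-2 * s) * t ^ (-2 * s - 1)) t :=
      (hasDerivAt_id t).rpow_const (Or.inl ht0.ne')
    have h3 := (((h1.sub_const 1).pow 2).mul h2).div_const (2 * s)
    refine h3.congr_deriv ?_
    have e1 : t ^ (-2 * s) = t * t ^ (-1 - 2 * s) := by
      rw [← Real.rpow_one_add' ht0.le (by linarith)]; congr 1; ring
    have e2 : t ^ (-2 * s - 1) = t ^ (-1 - 2 * s) := by congr 1; ring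
    have hp : 0 < 1 + t := by linarith
    have e3 : (1 + t) ^ s = (1 + t) * (1 + t) ^ (s - 1) := by
      conv_rhs => rw [← Real.rpow_one (1 + t), Real.rpow_one (1 + t)]
      rw [← Real.rpow_one_add' hp.le (by linarith)]; congr 1; ring
    have e4 : (1 + t) ^ (2 * s - 1) = (1 + t) * (1 + t) ^ (s - 1) * (1 + t) ^ (s - 1) := by
      rw [← e3, ← Real.rpow_add hp]; congr 1; ring
    simp only [Pi.pow_apply]
    rw [e1, e2, e4, e3]
    field_simp
    ring
  have hnn : ∀ t ∈ Ioi ε, 0 ≤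
      ((1 + t) ^ s - 1 + ((1 + t) ^ (s - 1) - (1 + t) ^ (2 * s - 1))) * t ^ (-1 - 2 * s) := by
    intro t ht
    have ht0 : 0 < t := hε.trans ht
    have hp : 1 ≤ 1 + t := by linarith
    have e4 : (1 + t) ^ (2 * s - 1) = (1 + t) ^ s * (1 + t) ^ (s - 1) := by
      rw [← Real.rpow_add (by linarith)]; congr 1; ring
    have a1 : 1 ≤ (1 + t) ^ s := Real.one_le_rpow hp hs.le
    have a2 : (1 + t) ^ (s - 1) ≤ 1 := Real.rpow_le_one_of_one_le_of_nonpos hp (by linarith)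
    refine mul_nonneg ?_ (by positivity)
    rw [e4]
    nlinarith
  have hlim : Tendsto (fun t : ℝ => ((1 + t) ^ s - 1) ^ 2 * t ^ (-2 * s) / (2 * s)) atTop
      (𝓝 (1 / (2 * s))) := by
    have h0 : Tendsto (fun t : ℝ => (1 + t⁻¹) ^ s - t ^ (-s)) atTop (𝓝 1) := by
      have := ((tendsto_inv_atTop_zero (𝕜 := ℝ)).const_add 1).rpow_const (p := s)
        (Or.inl (by norm_num))
      simpa using this.sub (tendsto_rpow_neg_atTop hs)
    have h1 := (h0.pow 2).div_const (2 * s)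
    rw [one_pow] at h1
    refine h1.congr' ?_
    filter_upwards [eventually_gt_atTop 0] with t ht
    have e1 : t ^ (-2 * s) = (t ^ (-s)) ^ 2 := by
      rw [← Real.rpow_natCast, ← Real.rpow_mul ht.le]; congr 1; push_cast; ring
    have e2 : (1 + t⁻¹) ^ s = (1 + t) ^ s * t ^ (-s) := by
      rw [Real.rpow_neg ht.le, ← Real.inv_rpow ht.le, ← Real.mul_rpow (by linarith) (by positivity)]
      congr 1; field_simp; ring
    rw [e1, e2]; ring
  exact ⟨integrableOn_Ioi_deriv_of_nonneg' hder hnn hlim,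
    integral_Ioi_of_hasDerivAt_of_nonneg' hder hnn hlim⟩

open Set in
theorem one_add_rpow_sub_one_le {s t : ℝ} (hs : 0 < s) (hs1 : s < 1) (ht : 0 ≤ t) :
    (1 + t) ^ s - 1 ≤ t := by
  have := rpow_one_add_le_one_add_mul_self (s := t) (by linarith) hs.le hs1.le
  nlinarith

open Set in
-- Substitute `t / (1 + t)` for the variable. This moves the part with `1 - t` to a half-line, where
-- it combines with the part with `1 + t` into an exact derivative.
theorem integral_Ioo_one_sub_rpow_sub_one {s ε : ℝ} (hε : 0 < ε) (hε1 : ε < 1) :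
    (∫ t in Ioo ε 1, ((1 - t) ^ s - 1) * t ^ (-1 - 2 * s)) =
      ∫ t in Ioi (ε / (1 - ε)), ((1 + t) ^ (s - 1) - (1 + t) ^ (2 * s - 1)) * t ^ (-1 - 2 * s) := by
  have h1ε : 0 < 1 - ε := by linarith
  have himg : (fun t : ℝ => t / (1 + t)) '' Ioi (ε / (1 - ε)) = Ioo ε 1 := by
    ext u
    constructor
    · rintro ⟨t, ht, rfl⟩
      have ht' : ε / (1 - ε) < t := ht
      rw [div_lt_iff₀ h1ε] at ht'
      have htp : 0 < t := lt_trans (by positivity) ht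
      exact ⟨by rw [lt_div_iff₀ (by linarith)]; linarith, by rw [div_lt_one (by linarith)]; linarith⟩
    · rintro ⟨h1, h2⟩
      have h1u : 0 < 1 - u := by linarith
      refine ⟨u / (1 - u), ?_, ?_⟩
      · simp only [mem_Ioi]
        rw [div_lt_div_iff₀ h1ε h1u]; nlinarith
      · simp only
        field_simp
        ring
  have hpos : ∀ t ∈ Ioi (ε / (1 - ε)), 0 < t := fun t ht => lt_trans (by positivity) ht
  have hder : ∀ t ∈ Ioi (ε / (1 - ε)), HasDerivWithinAt (fun t : ℝ => t / (1 + t))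
      ((1 + t) ^ 2)⁻¹ (Ioi (ε / (1 - ε))) t := by
    intro t ht
    have := hpos t ht
    have h := (hasDerivAt_id t).div ((hasDerivAt_id t).const_add 1) (by simp; positivity)
    refine HasDerivAt.hasDerivWithinAt (h.congr_deriv ?_)
    simp only [id]
    field_simp
    ring
  have hinj : InjOn (fun t : ℝ => t / (1 + t)) (Ioi (ε / (1 - ε))) := by
    intro x hx y hy hxy
    have := hpos x hx
    have := hpos y hy
    simp only at hxy
    rw [div_eq_div_iff (by positivity) (by positivity)] at hxy
    linarith
  rw [← himg, integral_image_eq_integral_abs_deriv_smul measurableSet_Ioi hder hinj]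
  refine setIntegral_congr_fun measurableSet_Ioi fun t ht => ?_
  have htp := hpos t ht
  have hp : 0 < 1 + t := by linarith
  have e1 : 1 - t / (1 + t) = (1 + t)⁻¹ := by field_simp; ring
  simp only [smul_eq_mul]
  rw [e1, abs_of_pos (by positivity), Real.div_rpow htp.le hp.le, Real.inv_rpow hp.le]
  have a : (1 + t) ^ (-1 - 2 * s) = ((1 + t) * ((1 + t) ^ s) ^ 2)⁻¹ := by
    rw [show -1 - 2 * s = -(1 + s * (2 : ℕ)) by push_cast; ring, Real.rpow_neg hp.le, Real.rpow_add hp,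
      Real.rpow_one, Real.rpow_mul hp.le, Real.rpow_natCast]
  have b : (1 + t) ^ (s - 1) = (1 + t) ^ s / (1 + t) := by
    rw [Real.rpow_sub hp, Real.rpow_one]
  have c : (1 + t) ^ (2 * s - 1) = ((1 + t) ^ s) ^ 2 / (1 + t) := by
    rw [Real.rpow_sub hp, Real.rpow_one, mul_comm 2 s, show s * 2 = s * (2 : ℕ) by simp,
      Real.rpow_mul hp.le, Real.rpow_natCast]
  have : 0 < (1 + t) ^ s := by positivity
  rw [a, b, c]
  field_simp

/-- The second difference at `0` of `t ↦ (1 + t)₊ ^ s`. -/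
noncomputable def powSecondDiff (s t : ℝ) : ℝ := max (1 + t) 0 ^ s + max (1 - t) 0 ^ s - 2

theorem powSecondDiff_neg (s t : ℝ) : powSecondDiff s (-t) = powSecondDiff s t := by
  simp only [powSecondDiff, sub_neg_eq_add, ← sub_eq_add_neg]; ring

theorem powSecondDiff_abs (s t : ℝ) : powSecondDiff s |t| = powSecondDiff s t := by
  rcases abs_choice t with h | h <;> rw [h]
  exact powSecondDiff_neg s t

theorem continuous_powSecondDiff {s : ℝ} (hs : 0 < s) : Continuous (powSecondDiff s) := by
  unfold powSecondDiff
  refine ((Continuous.rpow_const ?_ fun _ => Or.inr hs.le).add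
    (Continuous.rpow_const ?_ fun _ => Or.inr hs.le)).sub continuous_const <;> fun_prop

/-- Bernoulli's inequality at `t` and `-t` gives the sign; the lower bound is the
arithmetic-geometric mean inequality with `(1 - t ^ 2) ^ s ≥ 1 - t ^ 2`. -/
theorem abs_powSecondDiff_le_sq {s t : ℝ} (hs : 0 < s) (hs1 : s < 1) (ht : |t| ≤ 1) :
    |powSecondDiff s t| ≤ 2 * t ^ 2 := by
  obtain ⟨h1, h2⟩ := abs_le.1 ht
  have p1 := rpow_one_add_le_one_add_mul_self (s := t) h1 hs.le hs1.le
  have p2 := rpow_one_add_le_one_add_mul_self (s := -t) (by linarith) hs.le hs1.le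
  rw [← sub_eq_add_neg] at p2
  rw [powSecondDiff, max_eq_left (by linarith), max_eq_left (by linarith)]
  have q1 : 0 ≤ (1 + t) ^ s := Real.rpow_nonneg (by linarith) _
  have q2 : 0 ≤ (1 - t) ^ s := Real.rpow_nonneg (by linarith) _
  have hpq : (1 + t) ^ s * (1 - t) ^ s = (1 - t ^ 2) ^ s := by
    rw [← Real.mul_rpow (by linarith) (by linarith)]; congr 1; ring
  have ht2 : t ^ 2 ≤ 1 := by nlinarith
  have h3 : 1 - t ^ 2 ≤ (1 - t ^ 2) ^ s := by
    have := Real.rpow_le_rpow_of_exponent_ge' (x := 1 - t ^ 2) (by linarith) (by nlinarith) hs.le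
      hs1.le
    simpa using this
  have h4 : 2 * (1 - t ^ 2) ≤ (1 + t) ^ s + (1 - t) ^ s := by
    refine (pow_le_pow_iff_left₀ (by linarith) (by positivity) two_ne_zero).1 ?_
    nlinarith [sq_nonneg ((1 + t) ^ s - (1 - t) ^ s), sq_nonneg t]
  rw [abs_le]
  constructor <;> nlinarith

theorem abs_powSecondDiff_le_rpow {s : ℝ} (hs : 0 < s) (hs1 : s < 1) (t : ℝ) :
    |powSecondDiff s t| ≤ 2 * |t| ^ s := by
  rcases le_total |t| 1 with ht | ht
  · refine (abs_powSecondDiff_le_sq hs hs1 ht).trans ?_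
    have := Real.rpow_le_rpow_of_exponent_ge' (x := |t|) (abs_nonneg _) ht hs.le
      (show s ≤ (2 : ℕ) by push_cast; linarith)
    rw [Real.rpow_natCast, sq_abs] at this
    linarith
  · rw [← powSecondDiff_abs]
    generalize |t| = u at ht
    rw [powSecondDiff, max_eq_left (by linarith), max_eq_right (by linarith),
      Real.zero_rpow hs.ne', add_zero]
    have h1 : (1 + u) ^ s ≤ (2 * u) ^ s := Real.rpow_le_rpow (by linarith) (by linarith) hs.le
    rw [Real.mul_rpow (by norm_num) (by linarith)] at h1
    have h2 : (2 : ℝ) ^ s ≤ 2 := by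
      simpa using Real.rpow_le_rpow_of_exponent_le (x := 2) (by norm_num) hs1.le
    have h3 : 1 ≤ u ^ s := Real.one_le_rpow ht hs.le
    have h4 : 0 ≤ (1 + u) ^ s := by positivity
    rw [abs_le]
    constructor <;> nlinarith

open Set in
-- The tail `t > 1` of the `1 - t` part contributes `-1 / (2 * s)`, which cancels the value at
-- infinity of the primitive. What remains is the primitive at the new cutoff and the strip between
-- the two cutoffs, both of order `ε ^ (2 - 2 * s)`.
theorem abs_integral_Ioi_powSecondDiff_le {s ε : ℝ} (hs : 0 < s) (hs1 : s < 1) (hε : 0 < ε)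
    (hε1 : ε ≤ 1 / 2) :
    |∫ t in Ioi ε, powSecondDiff s t * t ^ (-1 - 2 * s)| ≤ (2 + 2 / s) * ε ^ (2 - 2 * s) := by
  have hpow : ∀ p : ℝ, p < -1 → IntegrableOn (fun t : ℝ => t ^ p) (Ioi ε) := fun p hp =>
    integrableOn_Ioi_rpow_of_lt hp hε
  have hK := hpow (-1 - 2 * s) (by linarith)
  have hA : IntegrableOn (fun t : ℝ => ((1 + t) ^ s - 1) * t ^ (-1 - 2 * s)) (Ioi ε) := by
    refine Integrable.mono' (hpow (-1 - s) (by linarith)) (by fun_prop) ?_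
    refine (ae_restrict_mem measurableSet_Ioi).mono fun t ht => ?_
    have ht0 : 0 < t := hε.trans ht
    have h1 : 1 ≤ (1 + t) ^ s := Real.one_le_rpow (by linarith) hs.le
    have h2 : (1 + t) ^ s ≤ 1 + t ^ s := by
      simpa using Real.rpow_add_le_add_rpow zero_le_one ht0.le hs.le hs1.le
    rw [Real.norm_eq_abs, abs_of_nonneg (mul_nonneg (by linarith) (by positivity)),
      show -1 - s = s + (-1 - 2 * s) by ring, Real.rpow_add ht0]
    gcongr
    linarith
  have hD : IntegrableOn (fun t : ℝ => (max (1 - t) 0 ^ s - 1) * t ^ (-1 - 2 * s)) (Ioi ε) := by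
    refine Integrable.mono' hK (by fun_prop) ?_
    refine (ae_restrict_mem measurableSet_Ioi).mono fun t ht => ?_
    have ht0 : 0 < t := hε.trans ht
    have h1 : 0 ≤ max (1 - t) 0 ^ s := by positivity
    have h2 : max (1 - t) 0 ^ s ≤ 1 :=
      Real.rpow_le_one (le_max_right _ _) (max_le (by linarith) zero_le_one) hs.le
    have h3 : 0 < t ^ (-1 - 2 * s) := by positivity
    rw [Real.norm_eq_abs, abs_mul, abs_of_pos h3]
    have : |max (1 - t) 0 ^ s - 1| ≤ 1 := abs_le.2 ⟨by linarith, by linarith⟩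
    nlinarith
  have hsplit : ∫ t in Ioi ε, powSecondDiff s t * t ^ (-1 - 2 * s) =
      (∫ t in Ioi ε, ((1 + t) ^ s - 1) * t ^ (-1 - 2 * s)) +
      ∫ t in Ioi ε, (max (1 - t) 0 ^ s - 1) * t ^ (-1 - 2 * s) := by
    rw [← integral_add hA hD]
    refine setIntegral_congr_fun measurableSet_Ioi fun t ht => ?_
    have ht0 : 0 < t := hε.trans ht
    simp only [powSecondDiff]
    rw [max_eq_left (by linarith)]
    ring
  have hD2 : ∫ t in Ioi ε, (max (1 - t) 0 ^ s - 1) * t ^ (-1 - 2 * s) =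
      (∫ t in Ioo ε 1, ((1 - t) ^ s - 1) * t ^ (-1 - 2 * s)) - 1 / (2 * s) := by
    have hU : Ioi ε = Ioc ε 1 ∪ Ioi 1 := (Ioc_union_Ioi_eq_Ioi (by linarith)).symm
    conv_lhs => rw [hU]
    rw [setIntegral_union (Ioc_disjoint_Ioi le_rfl) measurableSet_Ioi
      (hD.mono_set Ioc_subset_Ioi_self) (hD.mono_set (Ioi_subset_Ioi (by linarith))),
      integral_Ioc_eq_integral_Ioo]
    have i1 : ∫ t in Ioo ε 1, (max (1 - t) 0 ^ s - 1) * t ^ (-1 - 2 * s) =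
        ∫ t in Ioo ε 1, ((1 - t) ^ s - 1) * t ^ (-1 - 2 * s) := by
      refine setIntegral_congr_fun measurableSet_Ioo fun t ht => ?_
      rw [max_eq_left (by linarith [ht.2])]
    have i2 : ∫ t in Ioi (1 : ℝ), (max (1 - t) 0 ^ s - 1) * t ^ (-1 - 2 * s) =
        ∫ t in Ioi (1 : ℝ), -(t ^ (-1 - 2 * s)) := by
      refine setIntegral_congr_fun measurableSet_Ioi fun t ht => ?_
      have : (1 : ℝ) < t := ht
      rw [max_eq_right (by linarith), Real.zero_rpow hs.ne']
      ring
    rw [i1, i2, integral_neg, integral_Ioi_rpow_of_lt (by linarith) one_pos, Real.one_rpow,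
      show -1 - 2 * s + 1 = -(2 * s) by ring, neg_div_neg_eq]
    ring
  have h1ε : 0 < 1 - ε := by linarith
  -- The cutoff after the substitution. It differs from `ε` only at second order, so the strip `Ioc
  -- ε δ`, where the integrand is at most `ε ^ (-2 * s)`, is harmless.
  set δ := ε / (1 - ε) with hδ
  have hδ0 : 0 < δ := by positivity
  have hεδ : ε ≤ δ := by rw [hδ, le_div_iff₀ h1ε]; nlinarith
  have hδ2 : δ ≤ 2 * ε := by rw [hδ, div_le_iff₀ h1ε]; nlinarith
  have hδε : δ - ε ≤ 2 * ε ^ 2 := by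
    have : δ - ε = ε ^ 2 / (1 - ε) := by rw [hδ]; field_simp; ring
    rw [this, div_le_iff₀ h1ε]; nlinarith [sq_nonneg ε]
  obtain ⟨hT1, hT2⟩ := integral_Ioi_add_rpow_telescoping hs hs1 hδ0
  have hAδ := hA.mono_set (Ioi_subset_Ioi hεδ)
  have hB : IntegrableOn (fun t : ℝ => ((1 + t) ^ (s - 1) - (1 + t) ^ (2 * s - 1)) *
      t ^ (-1 - 2 * s)) (Ioi δ) := by
    refine (hT1.sub hAδ).congr (Filter.Eventually.of_forall fun t => ?_)
    simp only [Pi.sub_apply]; ring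
  have hT3 : (∫ t in Ioi δ, ((1 + t) ^ s - 1) * t ^ (-1 - 2 * s)) +
      (∫ t in Ioi δ, ((1 + t) ^ (s - 1) - (1 + t) ^ (2 * s - 1)) * t ^ (-1 - 2 * s)) =
      1 / (2 * s) - ((1 + δ) ^ s - 1) ^ 2 * δ ^ (-2 * s) / (2 * s) := by
    rw [← hT2, ← integral_add hAδ hB]
    congr 1
    ext t
    ring
  have hA2 : ∫ t in Ioi ε, ((1 + t) ^ s - 1) * t ^ (-1 - 2 * s) =
      (∫ t in Ioc ε δ, ((1 + t) ^ s - 1) * t ^ (-1 - 2 * s)) +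
      ∫ t in Ioi δ, ((1 + t) ^ s - 1) * t ^ (-1 - 2 * s) := by
    have hU : Ioi ε = Ioc ε δ ∪ Ioi δ := (Ioc_union_Ioi_eq_Ioi hεδ).symm
    conv_lhs => rw [hU]
    rw [setIntegral_union (Ioc_disjoint_Ioi le_rfl) measurableSet_Ioi
      (hA.mono_set Ioc_subset_Ioi_self) hAδ]
  have hbound : |∫ t in Ioc ε δ, ((1 + t) ^ s - 1) * t ^ (-1 - 2 * s)| ≤ 2 * ε ^ (2 - 2 * s) := by
    have := norm_setIntegral_le_of_norm_le_const (μ := volume) (s := Ioc ε δ) (C := ε ^ (-2 * s))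
      (f := fun t : ℝ => ((1 + t) ^ s - 1) * t ^ (-1 - 2 * s)) measure_Ioc_lt_top ?_
    · rw [Real.norm_eq_abs, Real.volume_real_Ioc_of_le hεδ] at this
      refine this.trans ?_
      have e : ε ^ (2 - 2 * s) = ε ^ (-2 * s) * ε ^ 2 := by
        rw [← Real.rpow_natCast, ← Real.rpow_add hε]; congr 1; push_cast; ring
      have : 0 < ε ^ (-2 * s) := by positivity
      rw [e]; nlinarith
    · intro t ht
      have ht0 : 0 < t := hε.trans ht.1
      have h1 : 1 ≤ (1 + t) ^ s := Real.one_le_rpow (by linarith) hs.le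
      have h2 := one_add_rpow_sub_one_le hs hs1 ht0.le
      rw [Real.norm_eq_abs, abs_of_nonneg (mul_nonneg (by linarith) (by positivity))]
      calc ((1 + t) ^ s - 1) * t ^ (-1 - 2 * s) ≤ t * t ^ (-1 - 2 * s) := by gcongr
        _ = t ^ (-2 * s) := by rw [← Real.rpow_one_add' ht0.le (by linarith)]; congr 1; ring
        _ ≤ ε ^ (-2 * s) := Real.rpow_le_rpow_of_nonpos hε ht.1.le (by linarith)
  have hF0 : 0 ≤ ((1 + δ) ^ s - 1) ^ 2 * δ ^ (-2 * s) / (2 * s) := by positivity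
  have hF : ((1 + δ) ^ s - 1) ^ 2 * δ ^ (-2 * s) / (2 * s) ≤ 2 / s * ε ^ (2 - 2 * s) := by
    have h1 : 1 ≤ (1 + δ) ^ s := Real.one_le_rpow (by linarith) hs.le
    have h2 := one_add_rpow_sub_one_le hs hs1 hδ0.le
    have h3 : ((1 + δ) ^ s - 1) ^ 2 * δ ^ (-2 * s) ≤ 4 * ε ^ (2 - 2 * s) := by
      calc ((1 + δ) ^ s - 1) ^ 2 * δ ^ (-2 * s) ≤ δ ^ 2 * δ ^ (-2 * s) := by gcongr
        _ = δ ^ (2 - 2 * s) := by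
          rw [← Real.rpow_natCast, ← Real.rpow_add hδ0]; congr 1; push_cast; ring
        _ ≤ (2 * ε) ^ (2 - 2 * s) := Real.rpow_le_rpow hδ0.le hδ2 (by linarith)
        _ = 2 ^ (2 - 2 * s) * ε ^ (2 - 2 * s) := Real.mul_rpow (by norm_num) hε.le
        _ ≤ 2 ^ (2 : ℝ) * ε ^ (2 - 2 * s) := by
          gcongr
          · norm_num
          · linarith
        _ = 4 * ε ^ (2 - 2 * s) := by norm_num
    calc _ ≤ 4 * ε ^ (2 - 2 * s) / (2 * s) := by gcongr
      _ = 2 / s * ε ^ (2 - 2 * s) := by field_simp; ring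
  rw [hsplit, hD2, integral_Ioo_one_sub_rpow_sub_one hε (by linarith), hA2, ← hδ]
  rw [abs_le] at hbound ⊢
  constructor <;> linarith [hbound.1, hbound.2]

open Set Filter Topology in
/-- `t ↦ t₊ ^ s` is annihilated by the one-dimensional fractional Laplacian of order `2 s`. -/
theorem integral_powSecondDiff_eq_zero {s : ℝ} (hs : 0 < s) (hs1 : s < 1)
    (hint : IntegrableOn (fun t => powSecondDiff s t * t ^ (-1 - 2 * s)) (Ioi 0)) :
    ∫ t in Ioi 0, powSecondDiff s t * t ^ (-1 - 2 * s) = 0 := by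
  have hid : Tendsto (fun ε : ℝ => ε) (𝓝[>] 0) (𝓝 0) := tendsto_id.mono_left nhdsWithin_le_nhds
  have h1 := (aecover_Ioi_of_Ioi (μ := volume) hid).integral_tendsto_of_countably_generated hint
  have h2 : Tendsto (fun ε : ℝ => (2 + 2 / s) * ε ^ (2 - 2 * s)) (𝓝[>] 0) (𝓝 0) := by
    have := (hid.rpow_const (p := 2 - 2 * s) (Or.inr (by linarith))).const_mul (2 + 2 / s)
    simpa [Real.zero_rpow (show 2 - 2 * s ≠ 0 by linarith)] using this
  refine tendsto_nhds_unique h1 (squeeze_zero_norm' ?_ h2)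
  filter_upwards [Ioo_mem_nhdsGT (show (0 : ℝ) < 1 / 2 by norm_num)] with ε hε
  rw [Measure.restrict_restrict measurableSet_Ioi, Ioi_inter_Ioi, sup_eq_left.2 hε.1.le]
  exact abs_integral_Ioi_powSecondDiff_le hs hs1 hε.1 hε.2.le

open Set in
theorem integral_powSecondDiff_mul_eq_zero {s : ℝ} (hs : 0 < s) (hs1 : s < 1) (c : ℝ)
    (hint : IntegrableOn (fun t => powSecondDiff s (c * t) * t ^ (-1 - 2 * s)) (Ioi 0)) :
    ∫ t in Ioi 0, powSecondDiff s (c * t) * t ^ (-1 - 2 * s) = 0 := by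
  rcases eq_or_ne c 0 with rfl | hc
  · simp only [zero_mul]
    have : powSecondDiff s 0 = 0 := by norm_num [powSecondDiff]
    simp [this]
  have hc' : 0 < |c| := abs_pos.2 hc
  have key : ∀ t ∈ Ioi (0 : ℝ), powSecondDiff s (c * t) * t ^ (-1 - 2 * s) =
      |c| ^ (1 + 2 * s) * (powSecondDiff s (|c| * t) * (|c| * t) ^ (-1 - 2 * s)) := by
    intro t ht
    have ht0 : 0 < t := ht
    rw [Real.mul_rpow hc'.le ht0.le, ← powSecondDiff_abs s (c * t), abs_mul, abs_of_pos ht0]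
    have : |c| ^ (1 + 2 * s) * |c| ^ (-1 - 2 * s) = 1 := by
      rw [← Real.rpow_add hc', ← Real.rpow_zero |c|]; congr 1; ring
    linear_combination (-(powSecondDiff s (|c| * t) * t ^ (-1 - 2 * s))) * this
  have hne : |c| ^ (1 + 2 * s) ≠ 0 := by positivity
  rw [setIntegral_congr_fun measurableSet_Ioi key, integral_const_mul]
  rw [integrableOn_congr_fun key measurableSet_Ioi] at hint
  have hint' := (integrable_const_mul_iff (IsUnit.mk0 _ hne) _).1 hint
  have h3 := (integrableOn_Ioi_comp_mul_left_iff
    (fun t => powSecondDiff s t * t ^ (-1 - 2 * s)) 0 hc').1 hint'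
  rw [mul_zero] at h3
  rw [integral_comp_mul_left_Ioi (fun t => powSecondDiff s t * t ^ (-1 - 2 * s)) 0 hc', mul_zero,
    integral_powSecondDiff_eq_zero hs hs1 h3]
  simp

/-! ### Integrals of powers over balls and their complements. -/

open Set Metric in
/-- If balls of radius `r ≥ η` have measure at most `A r ^ q`, then `‖y‖ ^ (-β)` with `β > q` is
integrable outside the ball of radius `η`, with an explicit bound. -/
theorem setLIntegral_compl_ball_norm_rpow_neg_le {E : Type*} [NormedAddCommGroup E]
    [MeasurableSpace E] [BorelSpace E] (μ : Measure E) [SFinite μ] {A : ℝ≥0∞} {q β η : ℝ}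
    (hη : 0 < η) (hβ : 0 < β) (hq : q < β)
    (h : ∀ r, η < r → μ (ball 0 r) ≤ A * ENNReal.ofReal (r ^ q)) :
    ∫⁻ y in (ball (0 : E) η)ᶜ, ENNReal.ofReal (‖y‖ ^ (-β)) ∂μ ≤
      A * ENNReal.ofReal (β / (β - q) * η ^ (q - β)) := by
  -- Layer cake: `‖y‖ ^ (-β)` is the integral of this density over `r > ‖y‖`; Tonelli then leaves
  -- only measures of balls.
  let k : ℝ → ℝ≥0∞ := fun r => ENNReal.ofReal (β * r ^ (-β - 1))
  have hk : Measurable k := by fun_prop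
  have tail : ∀ p t : ℝ, 0 < p → 0 < t →
      ∫⁻ r in Ioi t, ENNReal.ofReal (r ^ (-p - 1)) = ENNReal.ofReal (t ^ (-p) / p) := by
    intro p t hp ht
    rw [← ofReal_integral_eq_lintegral_ofReal (integrableOn_Ioi_rpow_of_lt (by linarith) ht)
      ((ae_restrict_mem measurableSet_Ioi).mono fun r hr => by
        have : 0 < r := ht.trans hr
        positivity), integral_Ioi_rpow_of_lt (by linarith) ht]
    congr 1
    rw [sub_add_cancel, neg_div_neg_eq]
  have h1 : ∀ y ∈ (ball (0 : E) η)ᶜ, ENNReal.ofReal (‖y‖ ^ (-β)) =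
      ∫⁻ r in Ioi η, {p : E × ℝ | ‖p.1‖ < p.2}.indicator (fun p => k p.2) (y, r) := by
    intro y hy
    have hy' : η ≤ ‖y‖ := by simpa using hy
    have : ∀ r, {p : E × ℝ | ‖p.1‖ < p.2}.indicator (fun p => k p.2) (y, r) =
        (Ioi ‖y‖).indicator k r := fun r => by simp [indicator]
    simp_rw [this]
    rw [lintegral_indicator measurableSet_Ioi, Measure.restrict_restrict measurableSet_Ioi,
      Ioi_inter_Ioi, sup_eq_left.2 hy']
    simp only [k]
    simp_rw [ENNReal.ofReal_mul hβ.le]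
    rw [lintegral_const_mul _ (by fun_prop), tail β _ hβ (hη.trans_le hy'),
      ← ENNReal.ofReal_mul hβ.le]
    congr 1
    field_simp
  have hS : MeasurableSet {p : E × ℝ | ‖p.1‖ < p.2} :=
    measurableSet_lt (by fun_prop) (by fun_prop)
  have hm : Measurable (Function.uncurry fun (y : E) (r : ℝ) =>
      {p : E × ℝ | ‖p.1‖ < p.2}.indicator (fun p => k p.2) (y, r)) :=
    (hk.comp measurable_snd).indicator hS
  rw [setLIntegral_congr_fun measurableSet_ball.compl h1, lintegral_lintegral_swap hm.aemeasurable]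
  have h2 : ∀ r ∈ Ioi η, (∫⁻ y in (ball (0 : E) η)ᶜ,
      {p : E × ℝ | ‖p.1‖ < p.2}.indicator (fun p => k p.2) (y, r) ∂μ) ≤
      A * ENNReal.ofReal β * ENNReal.ofReal (r ^ (-(β - q) - 1)) := by
    intro r hr
    have hr0 : 0 < r := hη.trans hr
    calc _ ≤ ∫⁻ y, {p : E × ℝ | ‖p.1‖ < p.2}.indicator (fun p => k p.2) (y, r) ∂μ :=
          setLIntegral_le_lintegral _ _
      _ = ∫⁻ y, (ball (0 : E) r).indicator (fun _ => k r) y ∂μ := by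
          congr 1; ext y; simp [indicator]
      _ = k r * μ (ball 0 r) := by rw [lintegral_indicator_const measurableSet_ball]
      _ ≤ k r * (A * ENNReal.ofReal (r ^ q)) := by gcongr; exact h r hr
      _ = A * ENNReal.ofReal β * (ENNReal.ofReal (r ^ (-β - 1)) * ENNReal.ofReal (r ^ q)) := by
          simp only [k]; rw [ENNReal.ofReal_mul hβ.le]; ring
      _ = _ := by
          rw [← ENNReal.ofReal_mul (by positivity), ← Real.rpow_add hr0]
          congr 3; ring
  refine (setLIntegral_mono (by fun_prop) h2).trans ?_
  rw [lintegral_const_mul _ (by fun_prop), tail (β - q) η (by linarith) hη, mul_assoc,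
    ← ENNReal.ofReal_mul hβ.le]
  refine le_of_eq ?_
  congr 2
  rw [neg_sub]
  ring

open Set Metric in
theorem setLIntegral_ball_norm_rpow_sub_finrank_le {E : Type*} [NormedAddCommGroup E]
    [NormedSpace ℝ E] [FiniteDimensional ℝ E] [Nontrivial E] [MeasurableSpace E] [BorelSpace E]
    (μ : Measure E) [μ.IsAddHaarMeasure] {p η : ℝ} (hp : 0 < p) (hη : 0 < η) :
    ∫⁻ y in ball (0 : E) η, ENNReal.ofReal (‖y‖ ^ (p - Module.finrank ℝ E)) ∂μ ≤
      ENNReal.ofReal (Module.finrank ℝ E * μ.real (ball 0 1) / p * η ^ p) := by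
  set d := Module.finrank ℝ E with hd
  have hd0 : 0 < d := Module.finrank_pos
  let f : ℝ → ℝ := (Iio η).indicator fun t => t ^ (p - d)
  have hf : ∀ t ∈ Ioi (0 : ℝ), t ^ (d - 1) • f t = (Iio η).indicator (fun t => t ^ (p - 1)) t := by
    intro t ht
    have ht0 : 0 < t := ht
    by_cases h : t < η
    · simp only [f, indicator, mem_Iio, h, if_true, smul_eq_mul]
      rw [← Real.rpow_natCast, ← Real.rpow_add ht0, Nat.cast_pred hd0]
      congr 1; ring
    · simp [f, h]
  have hIoo : Iio η ∩ Ioi (0 : ℝ) = Ioo 0 η := by rw [inter_comm]; rfl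
  have hI : IntegrableOn (fun t : ℝ => t ^ (p - 1)) (Ioo 0 η) :=
    (intervalIntegral.integrableOn_Ioo_rpow_iff hη).2 (by linarith)
  have hint : Integrable (fun y : E => f ‖y‖) μ := by
    rw [integrable_fun_norm_addHaar μ, integrableOn_congr_fun hf measurableSet_Ioi, IntegrableOn,
      integrable_indicator_iff measurableSet_Iio, IntegrableOn,
      Measure.restrict_restrict measurableSet_Iio, hIoo]
    exact hI
  have hnn : ∀ y : E, 0 ≤ f ‖y‖ := fun y => by
    by_cases h : ‖y‖ < η
    · simp only [f, indicator, mem_Iio, h, if_true]; positivity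
    · simp [f, h]
  have e1 : ∀ y : E, (ball (0 : E) η).indicator (fun y => ENNReal.ofReal (‖y‖ ^ (p - d))) y =
      ENNReal.ofReal (f ‖y‖) := by
    intro y
    by_cases h : ‖y‖ < η <;> simp [f, indicator, h]
  rw [← lintegral_indicator measurableSet_ball]
  simp_rw [e1]
  rw [← ofReal_integral_eq_lintegral_ofReal hint (Filter.Eventually.of_forall hnn),
    integral_fun_norm_addHaar μ, setIntegral_congr_fun measurableSet_Ioi hf,
    integral_indicator measurableSet_Iio, Measure.restrict_restrict measurableSet_Iio, hIoo,
    ← integral_Ioc_eq_integral_Ioo, ← intervalIntegral.integral_of_le hη.le,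
    integral_rpow (Or.inl (by linarith)), ← hd]
  refine le_of_eq ?_
  rw [sub_add_cancel, Real.zero_rpow hp.ne', sub_zero, nsmul_eq_mul, smul_eq_mul]
  congr 1
  ring

open Set in
theorem setLIntegral_Ioc_max_add_rpow_le {s r : ℝ} (hs : 0 < s) (hs1 : s < 1) (hr : 0 < r) (c : ℝ) :
    ∫⁻ τ in Ioc 0 r, ENNReal.ofReal (max (c + τ) 0 ^ (s - 1)) ≤ ENNReal.ofReal (r ^ s / s) := by
  -- With the convention `0 ^ (s - 1) = 0`, the integrand vanishes, instead of being infinite,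
  -- wherever `c + τ ≤ 0`.
  have hz : (0 : ℝ) ^ (s - 1) = 0 := Real.zero_rpow (by linarith)
  have key : ∫⁻ τ in Ioc 0 r, ENNReal.ofReal (max (c + τ) 0 ^ (s - 1)) ≤
      ∫⁻ τ in Ioc 0 r, ENNReal.ofReal (τ ^ (s - 1)) := by
    rcases le_total 0 c with hc | hc
    · refine setLIntegral_mono (by fun_prop) fun τ hτ => ENNReal.ofReal_le_ofReal ?_
      rw [max_eq_left (by linarith [hτ.1])]
      exact Real.rpow_le_rpow_of_nonpos hτ.1 (by linarith) (by linarith)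
    · rw [← lintegral_indicator measurableSet_Ioc, ← lintegral_indicator measurableSet_Ioc,
        ← lintegral_add_left_eq_self _ (-c)]
      refine lintegral_mono fun u => ?_
      by_cases hu : -c + u ∈ Ioc 0 r
      · rw [indicator_of_mem hu, add_neg_cancel_left]
        rcases le_or_gt u 0 with h0 | h0
        · simp [max_eq_right h0, hz]
        · rw [indicator_of_mem (show u ∈ Ioc 0 r from ⟨h0, by linarith [hu.2]⟩), max_eq_left h0.le]
      · rw [indicator_of_notMem hu]
        exact zero_le
  refine key.trans (le_of_eq ?_)
  rw [← ofReal_integral_eq_lintegral_ofReal, ← intervalIntegral.integral_of_le hr.le,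
    integral_rpow (Or.inl (by linarith))]
  · simp [Real.zero_rpow hs.ne']
  · rw [← IntegrableOn, integrableOn_Ioc_iff_integrableOn_Ioo]
    exact (intervalIntegral.integrableOn_Ioo_rpow_iff hr).2 (by linarith)
  · exact (ae_restrict_mem measurableSet_Ioc).mono fun τ hτ => Real.rpow_nonneg hτ.1.le _

open Set Metric in
/-- Integral over a ball of a negative power of a function that grows at unit speed along `v`. -/
theorem setLIntegral_ball_max_rpow_le {E : Type*} [NormedAddCommGroup E]
    [NormedSpace ℝ E] [FiniteDimensional ℝ E] [MeasurableSpace E] [BorelSpace E]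
    (μ : Measure E) [μ.IsAddHaarMeasure] {s m r : ℝ} (hs : 0 < s) (hs1 : s < 1) (hr : 0 < r)
    {f : E → ℝ} (hf : Measurable f) {v : E} (hv : ‖v‖ ≤ m)
    (hfv : ∀ x (τ : ℝ), f (x + τ • v) = f x + τ) (x₀ : E) :
    ∫⁻ x in ball x₀ r, ENNReal.ofReal (max (f x) 0 ^ (s - 1)) ∂μ ≤
      μ (ball x₀ ((1 + m) * r)) * ENNReal.ofReal (r ^ (s - 1) / s) := by
  set F : E → ℝ≥0∞ := fun x => ENNReal.ofReal (max (f x) 0 ^ (s - 1)) with hF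
  have hFm : Measurable F := by fun_prop
  have hm : 0 ≤ m := (norm_nonneg v).trans hv
  -- Averaging over the translations by `τ • v`, `0 < τ ≤ r`, at the cost of a larger ball, reduces
  -- the claim to an integral along lines, where `f` is `τ` plus a constant.
  have h1 : ∀ τ ∈ Ioc 0 r, ∫⁻ x in ball x₀ r, F x ∂μ ≤
      ∫⁻ x in ball x₀ ((1 + m) * r), F (x + τ • v) ∂μ := by
    intro τ hτ
    rw [← lintegral_indicator measurableSet_ball, ← lintegral_indicator measurableSet_ball,
      ← lintegral_add_right_eq_self _ (τ • v)]
    refine lintegral_mono fun x => ?_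
    by_cases hx : x + τ • v ∈ ball x₀ r
    · have : x ∈ ball x₀ ((1 + m) * r) := by
        rw [mem_ball, dist_eq_norm] at hx ⊢
        calc ‖x - x₀‖ = ‖(x + τ • v - x₀) - τ • v‖ := by congr 1; abel
          _ ≤ ‖x + τ • v - x₀‖ + ‖τ • v‖ := norm_sub_le _ _
          _ < r + r * m := by
            rw [norm_smul, Real.norm_of_nonneg hτ.1.le]
            have : τ * ‖v‖ ≤ r * m := mul_le_mul hτ.2 hv (norm_nonneg _) hr.le
            linarith
          _ = (1 + m) * r := by ring
      rw [indicator_of_mem hx, indicator_of_mem this]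
    · rw [indicator_of_notMem hx]
      exact zero_le
  have hsw : Measurable (Function.uncurry fun (τ : ℝ) (x : E) => F (x + τ • v)) := by
    have : Measurable fun p : ℝ × E => p.2 + p.1 • v := by fun_prop
    exact hFm.comp this
  have h2 : ENNReal.ofReal r * ∫⁻ x in ball x₀ r, F x ∂μ ≤
      μ (ball x₀ ((1 + m) * r)) * ENNReal.ofReal (r ^ s / s) := by
    calc ENNReal.ofReal r * ∫⁻ x in ball x₀ r, F x ∂μ
        = ∫⁻ τ in Ioc (0 : ℝ) r, ∫⁻ x in ball x₀ r, F x ∂μ := by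
          rw [setLIntegral_const, Real.volume_Ioc, sub_zero, mul_comm]
      _ ≤ ∫⁻ τ in Ioc (0 : ℝ) r, ∫⁻ x in ball x₀ ((1 + m) * r), F (x + τ • v) ∂μ :=
          setLIntegral_mono' measurableSet_Ioc h1
      _ = ∫⁻ x in ball x₀ ((1 + m) * r), (∫⁻ τ in Ioc (0 : ℝ) r, F (x + τ • v)) ∂μ :=
          lintegral_lintegral_swap (hsw.aemeasurable)
      _ ≤ ∫⁻ x in ball x₀ ((1 + m) * r), ENNReal.ofReal (r ^ s / s) ∂μ := by
          refine lintegral_mono fun x => ?_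
          simp only [hF, hfv]
          exact setLIntegral_Ioc_max_add_rpow_le hs hs1 hr (f x)
      _ = _ := by rw [setLIntegral_const, mul_comm]
  have hr' : ENNReal.ofReal r ≠ 0 := by simpa using hr
  have h3 : r ^ s / s = r * (r ^ (s - 1) / s) := by
    rw [Real.rpow_sub hr, Real.rpow_one]; field_simp
  rw [h3, ENNReal.ofReal_mul hr.le, mul_left_comm] at h2
  exact (ENNReal.mul_le_mul_iff_right hr' ENNReal.ofReal_ne_top).1 h2

/-! ### Stable operators: kernel bounds and vanishing on powers of affine functions. -/

namespace StableBarrier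

open Set Metric

instance {n : ℕ} [NeZero n] : Nontrivial (RR n) :=
  Module.nontrivial_of_finrank_pos (R := ℝ) (by simp [Nat.pos_of_neZero])

theorem setLIntegral_ball_kernel_le {n : ℕ} [NeZero n] {s A η : ℝ} (hs1 : s < 1) (hη : 0 < η)
    (hA : 0 ≤ A) {w : RR n → ℝ} (hw : ∀ y ∈ ball (0 : RR n) η, |w y| ≤ A * ‖y‖ ^ 2) :
    ∫⁻ y in ball (0 : RR n) η, ENNReal.ofReal (|w y| * ‖y‖ ^ (-((n : ℝ) + 2 * s))) ≤
      ENNReal.ofReal (n * volume.real (ball (0 : RR n) 1) / (2 - 2 * s) * A * η ^ (2 - 2 * s)) := by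
  have h := setLIntegral_ball_norm_rpow_sub_finrank_le (E := RR n) volume
    (p := 2 - 2 * s) (by linarith) hη
  rw [finrank_euclideanSpace_fin] at h
  calc _ ≤ ∫⁻ y in ball (0 : RR n) η, ENNReal.ofReal A *
        ENNReal.ofReal (‖y‖ ^ (2 - 2 * s - (n : ℝ))) := by
        refine setLIntegral_mono' measurableSet_ball fun y hy => ?_
        rw [← ENNReal.ofReal_mul hA]
        refine ENNReal.ofReal_le_ofReal ?_
        have hwy := hw y hy
        rcases eq_or_ne y 0 with rfl | hy0
        · have : |w 0| = 0 := le_antisymm (by simpa using hwy) (abs_nonneg _)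
          rw [this, zero_mul]
          positivity
        · have hy1 : 0 < ‖y‖ := norm_pos_iff.2 hy0
          calc |w y| * ‖y‖ ^ (-((n : ℝ) + 2 * s)) ≤
              A * ‖y‖ ^ 2 * ‖y‖ ^ (-((n : ℝ) + 2 * s)) := by gcongr
            _ = A * ‖y‖ ^ (2 - 2 * s - (n : ℝ)) := by
              rw [mul_assoc, ← Real.rpow_natCast, ← Real.rpow_add hy1]
              congr 2; push_cast; ring
    _ = ENNReal.ofReal A * ∫⁻ y in ball (0 : RR n) η,
        ENNReal.ofReal (‖y‖ ^ (2 - 2 * s - (n : ℝ))) := lintegral_const_mul _ (by fun_prop)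
    _ ≤ _ := by grw [h]
    _ = _ := by
      rw [← ENNReal.ofReal_mul hA]
      congr 1; ring

theorem setLIntegral_compl_ball_kernel_le {n : ℕ} [NeZero n] {s A η : ℝ} (hs : 0 < s) (hη : 0 < η)
    (hA : 0 ≤ A) {w : RR n → ℝ} (hw : ∀ y ∈ (ball (0 : RR n) η)ᶜ, |w y| ≤ A * ‖y‖ ^ s) :
    ∫⁻ y in (ball (0 : RR n) η)ᶜ, ENNReal.ofReal (|w y| * ‖y‖ ^ (-((n : ℝ) + 2 * s))) ≤
      ENNReal.ofReal (volume.real (ball (0 : RR n) 1) * ((n + s) / s) * A * η ^ (-s)) := by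
  have hball : ∀ r, η < r → volume (ball (0 : RR n) r) ≤
      volume (ball (0 : RR n) 1) * ENNReal.ofReal (r ^ (n : ℝ)) := by
    intro r hr
    rw [Measure.addHaar_ball _ _ (hη.trans hr).le, finrank_euclideanSpace_fin, mul_comm,
      Real.rpow_natCast]
  have h := setLIntegral_compl_ball_norm_rpow_neg_le (volume : Measure (RR n)) (q := n)
    (β := n + s) hη (by positivity) (by linarith) hball
  calc _ ≤ ∫⁻ y in (ball (0 : RR n) η)ᶜ, ENNReal.ofReal A *
        ENNReal.ofReal (‖y‖ ^ (-((n : ℝ) + s))) := by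
        refine setLIntegral_mono' measurableSet_ball.compl fun y hy => ?_
        rw [← ENNReal.ofReal_mul hA]
        refine ENNReal.ofReal_le_ofReal ?_
        have hy1 : 0 < ‖y‖ := hη.trans_le (by simpa using hy)
        calc |w y| * ‖y‖ ^ (-((n : ℝ) + 2 * s)) ≤
              A * ‖y‖ ^ s * ‖y‖ ^ (-((n : ℝ) + 2 * s)) := by gcongr; exact hw y hy
            _ = A * ‖y‖ ^ (-((n : ℝ) + s)) := by
              rw [mul_assoc, ← Real.rpow_add hy1]
              congr 2; ring
    _ = ENNReal.ofReal A * ∫⁻ y in (ball (0 : RR n) η)ᶜ,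
        ENNReal.ofReal (‖y‖ ^ (-((n : ℝ) + s))) := lintegral_const_mul _ (by fun_prop)
    _ ≤ _ := by grw [h]
    _ = _ := by
      rw [← ENNReal.ofReal_toReal (measure_ball_lt_top (μ := volume) (x := (0 : RR n)) (r := 1)).ne,
        ← ENNReal.ofReal_mul ENNReal.toReal_nonneg, ← ENNReal.ofReal_mul hA]
      congr 1
      rw [add_sub_cancel_left, sub_add_cancel_left, measureReal_def]
      ring

theorem IsEllipticDensity.measurable_comp_normalize {n : ℕ} {lam Lam : ℝ} {a : RR n → ℝ}
    (ha : IsEllipticDensity lam Lam a) : Measurable fun y : RR n => a (‖y‖⁻¹ • y) := by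
  refine measurable_of_measurable_on_compl_singleton 0 ?_
  have h1 : Measurable fun y : {y : RR n | y ≠ 0} =>
      (⟨‖(y : RR n)‖⁻¹ • (y : RR n), by
        simpa using norm_smul_inv_norm (𝕜 := ℝ) y.2⟩ : sphere (0 : RR n) 1) := by
    refine Measurable.subtype_mk ?_
    fun_prop
  exact ha.measurable.comp h1

theorem IsEllipticDensity.abs_kernel_le {n : ℕ} {lam Lam : ℝ} {a : RR n → ℝ} (hlam : 0 < lam)
    (ha : IsEllipticDensity lam Lam a) (s : ℝ) {y : RR n} (hy : y ≠ 0) :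
    |a (‖y‖⁻¹ • y) / ‖y‖ ^ ((n : ℝ) + 2 * s)| ≤ Lam * ‖y‖ ^ (-((n : ℝ) + 2 * s)) := by
  have hn : ‖‖y‖⁻¹ • y‖ = 1 := by simpa using norm_smul_inv_norm (𝕜 := ℝ) hy
  have h1 := ha.lower _ hn
  have h2 := ha.upper _ hn
  rw [Real.rpow_neg (norm_nonneg y), ← div_eq_mul_inv, abs_div,
    abs_of_nonneg (Real.rpow_nonneg (norm_nonneg y) _), abs_of_pos (hlam.trans_le h1)]
  gcongr

/-- Integrability against the kernel from a bound without the angular density. -/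
theorem IsEllipticDensity.integrable_mul_kernel {n : ℕ} [NeZero n] {lam Lam : ℝ} {a : RR n → ℝ}
    (hlam : 0 < lam) (ha : IsEllipticDensity lam Lam a) {s B : ℝ} {w : RR n → ℝ}
    (hw : Measurable w) (hB : 0 ≤ B) (h : ∫⁻ y, ENNReal.ofReal (|w y| * ‖y‖ ^ (-((n : ℝ) + 2 * s))) ≤
      ENNReal.ofReal B) :
    Integrable (fun y => w y * (a (‖y‖⁻¹ • y) / ‖y‖ ^ ((n : ℝ) + 2 * s))) ∧
      |∫ y, w y * (a (‖y‖⁻¹ • y) / ‖y‖ ^ ((n : ℝ) + 2 * s))| ≤ |Lam| * B := by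
  have hm : Measurable fun y => w y * (a (‖y‖⁻¹ • y) / ‖y‖ ^ ((n : ℝ) + 2 * s)) :=
    hw.mul (ha.measurable_comp_normalize.div (by fun_prop))
  have hle : ∫⁻ y, ‖w y * (a (‖y‖⁻¹ • y) / ‖y‖ ^ ((n : ℝ) + 2 * s))‖ₑ ≤
      ENNReal.ofReal (|Lam| * B) := by
    calc _ ≤ ∫⁻ y, ENNReal.ofReal |Lam| *
          ENNReal.ofReal (|w y| * ‖y‖ ^ (-((n : ℝ) + 2 * s))) := by
          refine lintegral_mono_ae ?_
          filter_upwards [Measure.ae_ne volume (0 : RR n)] with y hy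
          rw [← ENNReal.ofReal_mul (abs_nonneg _), ← ofReal_norm, Real.norm_eq_abs, abs_mul]
          refine ENNReal.ofReal_le_ofReal ?_
          calc _ ≤ |w y| * (Lam * ‖y‖ ^ (-((n : ℝ) + 2 * s))) := by
                gcongr; exact ha.abs_kernel_le hlam s hy
            _ ≤ |w y| * (|Lam| * ‖y‖ ^ (-((n : ℝ) + 2 * s))) := by
                gcongr; exact le_abs_self _
            _ = _ := by ring
      _ = ENNReal.ofReal |Lam| * _ := lintegral_const_mul _ (by fun_prop)
      _ ≤ ENNReal.ofReal |Lam| * ENNReal.ofReal B := by gcongr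
      _ = _ := (ENNReal.ofReal_mul (abs_nonneg _)).symm
  refine ⟨⟨hm.aestronglyMeasurable, hle.trans_lt ENNReal.ofReal_lt_top⟩, ?_⟩
  rw [← Real.norm_eq_abs]
  refine (norm_integral_le_lintegral_norm _).trans ?_
  refine ENNReal.toReal_le_of_le_ofReal (by positivity) ?_
  simpa only [ofReal_norm] using hle

/-- In polar coordinates the density is constant on each ray, where the integrand becomes `a θ`
times the one-dimensional integrand with slope `L θ`. So no symmetry of `a` is needed. -/
theorem integral_powSecondDiff_mul_kernel_eq_zero {n : ℕ} [NeZero n] (a : RR n → ℝ) {s : ℝ}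
    (hs : 0 < s) (hs1 : s < 1) (L : RR n →L[ℝ] ℝ)
    (hint : Integrable fun y => powSecondDiff s (L y) *
      (a (‖y‖⁻¹ • y) / ‖y‖ ^ ((n : ℝ) + 2 * s))) :
    ∫ y, powSecondDiff s (L y) * (a (‖y‖⁻¹ • y) / ‖y‖ ^ ((n : ℝ) + 2 * s)) = 0 := by
  set H : RR n → ℝ := fun y => powSecondDiff s (L y) *
    (a (‖y‖⁻¹ • y) / ‖y‖ ^ ((n : ℝ) + 2 * s)) with hH
  let G : sphere (0 : RR n) 1 × Ioi (0 : ℝ) → ℝ := fun p => H (p.2.1 • p.1.1)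
  have hGH : ∀ x : ({0}ᶜ : Set (RR n)), G (homeomorphUnitSphereProd (RR n) x) = H x := by
    intro x
    have hx : ‖(x : RR n)‖ ≠ 0 := norm_ne_zero_iff.2 x.2
    simp only [G]
    congr 1
    simp [smul_smul, hx]
  have hmp := (volume : Measure (RR n)).measurePreserving_homeomorphUnitSphereProd
  have hemb := (homeomorphUnitSphereProd (RR n)).measurableEmbedding
  have hGi : Integrable G ((volume : Measure (RR n)).toSphere.prod
      (Measure.volumeIoiPow (Module.finrank ℝ (RR n) - 1))) := by
    rw [← hmp.integrable_comp_emb hemb]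
    have : G ∘ (homeomorphUnitSphereProd (RR n)) = H ∘ Subtype.val := funext hGH
    rw [this, ← integrableOn_iff_comap_subtypeVal (measurableSet_singleton _).compl]
    exact hint.integrableOn
  calc ∫ y, H y = ∫ x : ({(0)}ᶜ : Set (RR n)), H x.1 ∂(volume.comap Subtype.val) := by
        rw [integral_subtype_comap (measurableSet_singleton _).compl H, restrict_compl_singleton]
    _ = ∫ p, G p ∂((volume : Measure (RR n)).toSphere.prod
      (Measure.volumeIoiPow (Module.finrank ℝ (RR n) - 1))) := by
        rw [← hmp.integral_comp hemb]
        exact integral_congr_ae (Filter.Eventually.of_forall fun x => (hGH x).symm)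
    _ = ∫ θ, ∫ r, G (θ, r) ∂(Measure.volumeIoiPow (Module.finrank ℝ (RR n) - 1))
          ∂(volume : Measure (RR n)).toSphere := integral_prod _ hGi
    _ = 0 := by
        refine integral_eq_zero_of_ae (Filter.Eventually.of_forall fun θ => ?_)
        have hθ : ‖(θ : RR n)‖ = 1 := by simp
        have hn : 0 < n := Nat.pos_of_neZero n
        have hzero : ∫ t in Ioi 0, powSecondDiff s (L θ * t) * t ^ (-1 - 2 * s) = 0 := by
          -- Without integrability on a ray the Bochner integral is zero by convention, so both
          -- cases give the same value.
          by_cases hi : IntegrableOn (fun t => powSecondDiff s (L θ * t) * t ^ (-1 - 2 * s)) (Ioi 0)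
          · exact integral_powSecondDiff_mul_eq_zero hs hs1 _ hi
          · exact integral_undef hi
        simp only [Measure.volumeIoiPow, ENNReal.ofReal]
        rw [integral_withDensity_eq_integral_smul
          (by exact (measurable_subtype_coe.pow_const _).real_toNNReal)]
        have e := integral_subtype_comap (μ := volume) (measurableSet_Ioi (a := (0 : ℝ)))
          (fun r : ℝ => Real.toNNReal (r ^ (Module.finrank ℝ (RR n) - 1)) • H (r • (θ : RR n)))
        refine e.trans ?_
        refine Eq.trans ?_ (show a θ * ∫ t in Ioi 0, powSecondDiff s (L θ * t) *
          t ^ (-1 - 2 * s) = 0 by rw [hzero, mul_zero])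
        rw [← integral_const_mul]
        refine setIntegral_congr_fun measurableSet_Ioi fun r hr => ?_
        have hr0 : 0 < r := hr
        have hnr : ‖r • (θ : RR n)‖ = r := by rw [norm_smul, hθ, mul_one, Real.norm_of_nonneg hr0.le]
        simp only [hH]
        rw [hnr, smul_smul, inv_mul_cancel₀ hr0.ne', one_smul, map_smul, smul_eq_mul,
          NNReal.smul_def, Real.coe_toNNReal _ (by positivity), smul_eq_mul,
          finrank_euclideanSpace_fin, mul_comm r (L θ)]
        have : r ^ (n - 1) / r ^ ((n : ℝ) + 2 * s) = r ^ (-1 - 2 * s) := by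
          rw [← Real.rpow_natCast, ← Real.rpow_sub hr0, Nat.cast_pred hn]
          congr 1; ring
        rw [← this]
        ring

/-- Translates of `t ↦ t₊ ^ s` along a linear functional are in the kernel of every stable
operator of order `2 s`, where they are positive. -/
theorem IsEllipticDensity.integral_powSecondDiff_mul_kernel {n : ℕ} [NeZero n] {lam Lam : ℝ}
    {a : RR n → ℝ} (hlam : 0 < lam) (ha : IsEllipticDensity lam Lam a) {s : ℝ} (hs : 0 < s)
    (hs1 : s < 1) (L : RR n →L[ℝ] ℝ) :
    Integrable (fun y => powSecondDiff s (L y) * (a (‖y‖⁻¹ • y) / ‖y‖ ^ ((n : ℝ) + 2 * s))) ∧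
      ∫ y, powSecondDiff s (L y) * (a (‖y‖⁻¹ • y) / ‖y‖ ^ ((n : ℝ) + 2 * s)) = 0 := by
  have hL : 0 < ‖L‖ + 1 := by positivity
  have hη : 0 < (‖L‖ + 1)⁻¹ := by positivity
  have h1 := setLIntegral_ball_kernel_le (n := n) (A := 2 * ‖L‖ ^ 2) hs1 hη (by positivity)
    (w := fun y => powSecondDiff s (L y)) (fun y hy => by
      have hLy := L.le_opNorm y
      rw [Real.norm_eq_abs] at hLy
      have hy1 : ‖y‖ < (‖L‖ + 1)⁻¹ := by simpa using hy
      have : ‖L‖ * ‖y‖ ≤ 1 := by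
        have h2 := mul_lt_mul_of_pos_left hy1 hL
        rw [mul_inv_cancel₀ hL.ne'] at h2
        nlinarith [norm_nonneg y]
      refine (abs_powSecondDiff_le_sq hs hs1 (hLy.trans this)).trans ?_
      rw [mul_assoc, ← mul_pow, ← sq_abs (L y)]
      gcongr)
  have h2 := setLIntegral_compl_ball_kernel_le (n := n) (A := 2 * ‖L‖ ^ s) hs hη (by positivity)
    (w := fun y => powSecondDiff s (L y)) (fun y hy => by
      have hLy := L.le_opNorm y
      rw [Real.norm_eq_abs] at hLy
      refine (abs_powSecondDiff_le_rpow hs hs1 _).trans ?_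
      rw [mul_assoc, ← Real.mul_rpow (norm_nonneg _) (norm_nonneg _)]
      gcongr)
  have h3 := lintegral_add_compl (μ := volume)
    (fun y => ENNReal.ofReal (|powSecondDiff s (L y)| * ‖y‖ ^ (-((n : ℝ) + 2 * s))))
    (measurableSet_ball (x := (0 : RR n)) (ε := (‖L‖ + 1)⁻¹))
  have h4 := add_le_add h1 h2
  rw [h3, ← ENNReal.ofReal_add (by
    have : 0 < 2 - 2 * s := by linarith
    positivity) (by positivity)] at h4
  have hi := (ha.integrable_mul_kernel hlam (w := fun y => powSecondDiff s (L y))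
    ((continuous_powSecondDiff hs).measurable.comp L.continuous.measurable) (by
      have : 0 < 2 - 2 * s := by linarith
      positivity) h4).1
  exact ⟨hi, integral_powSecondDiff_mul_kernel_eq_zero a hs hs1 L hi⟩

/-! ### Boundary charts. -/

/-- On the ball of radius `R` around `z` the set `Ω` is the positivity set of an `M`-Lipschitz
function that grows at unit speed in the direction of the unit vector `e`. -/
structure IsLipschitzChart {n : ℕ} (Ω : Set (RR n)) (R M : ℝ) (z e : RR n) (f : RR n → ℝ) :
    Prop where
  norm_eq : ‖e‖ = 1
  continuous : Continuous f
  shift : ∀ x (τ : ℝ), f (x + τ • e) = f x + τ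
  lipschitz : ∀ x ∈ ball z R, ∀ y ∈ ball z R, f x - f y ≤ M * ‖x - y‖
  mem_iff : ∀ x ∈ ball z R, x ∈ Ω ↔ 0 < f x

theorem IsLipschitzChart.mono {n : ℕ} {Ω : Set (RR n)} {R M M' : ℝ} {z e : RR n} {f : RR n → ℝ}
    (h : IsLipschitzChart Ω R M z e f) (hM : M ≤ M') : IsLipschitzChart Ω R M' z e f :=
  { h with lipschitz := fun x hx y hy => (h.lipschitz x hx y hy).trans (by gcongr) }

/-- The domain hypothesis does not bound the gradients of the graphs uniformly in the boundary
point. Compactness of the boundary supplies a common Lipschitz constant, since the chart at `z` also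
serves all boundary points of `ball z (r / 2)`. The defining function is the height above the graph.
-/
theorem exists_lipschitzChart {n : ℕ} {α : ℝ} {Ω : Set (RR n)} (hΩb : Bornology.IsBounded Ω)
    (hΩ : IsC1HolderDomain α Ω) :
    ∃ R > 0, R ≤ 1 ∧ ∃ M ≥ 1, ∀ z ∈ frontier Ω, ∃ e f, IsLipschitzChart Ω R M z e f := by
  obtain ⟨-, r, hr, K, h⟩ := hΩ
  have hR : 0 < min (r / 2) 1 := by positivity
  have hcomp : IsCompact (frontier Ω) :=
    isCompact_of_isClosed_isBounded isClosed_frontier (hΩb.closure.subset frontier_subset_closure)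
  refine ⟨min (r / 2) 1, hR, min_le_right _ _, ?_⟩
  refine hcomp.induction_on (p := fun S => ∃ M ≥ 1, ∀ z ∈ S, ∃ e f,
    IsLipschitzChart Ω (min (r / 2) 1) M z e f) ⟨1, le_rfl, by simp⟩ ?_ ?_ ?_
  · rintro S T hST ⟨M, hM, hT⟩
    exact ⟨M, hM, fun z hz => hT z (hST hz)⟩
  · rintro S T ⟨M, hM, hS⟩ ⟨M', hM', hT⟩
    refine ⟨max M M', le_max_of_le_left hM, fun z hz => ?_⟩
    rcases hz with hz | hz
    · obtain ⟨e, f, hf⟩ := hS z hz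
      exact ⟨e, f, hf.mono (le_max_left _ _)⟩
    · obtain ⟨e, f, hf⟩ := hT z hz
      exact ⟨e, f, hf.mono (le_max_right _ _)⟩
  · intro z hz
    obtain ⟨e, γ, he, hγ, -, hmem⟩ := h z hz
    let f : RR n → ℝ := fun x => inner ℝ e x - γ (x - inner ℝ e x • e)
    have hinner : ContDiff ℝ 1 fun x : RR n => (inner ℝ e x : ℝ) := contDiff_const.inner ℝ contDiff_id
    have hf : ContDiff ℝ 1 f :=
      hinner.sub (hγ.comp (contDiff_id.sub (hinner.smul contDiff_const)))
    obtain ⟨L, hL⟩ := hf.contDiffOn.exists_lipschitzOnWith (s := closedBall z r) one_ne_zero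
      (convex_closedBall z r) (isCompact_closedBall z r)
    refine ⟨ball z (r / 2), mem_nhdsWithin_of_mem_nhds (ball_mem_nhds z (by positivity)),
      max 1 L, le_max_left _ _, fun w hw => ⟨e, f, ?_⟩⟩
    have hsub : ball w (min (r / 2) 1) ⊆ ball z r := by
      refine (ball_subset_ball (min_le_left _ _)).trans (ball_subset_ball' ?_)
      have : dist w z < r / 2 := hw
      linarith
    have hee : inner ℝ e e = (1 : ℝ) := by rw [real_inner_self_eq_norm_sq, he, one_pow]
    refine ⟨he, hf.continuous, fun x τ => ?_, fun x hx y hy => ?_, fun x hx => ?_⟩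
    · simp only [f, inner_add_right, inner_smul_right, hee, mul_one]
      have : x + τ • e - (inner ℝ e x + τ) • e = x - inner ℝ e x • e := by
        rw [add_smul]; abel
      rw [this]
      ring
    · have h1 := hL.dist_le_mul x (ball_subset_closedBall (hsub hx)) y
        (ball_subset_closedBall (hsub hy))
      rw [Real.dist_eq, dist_eq_norm] at h1
      refine (le_abs_self _).trans (h1.trans ?_)
      gcongr
      exact le_max_right _ _
    · rw [hmem x (hsub hx), sub_pos]

/-- At points of the complement inside the ball `f ≤ 0`, so the Lipschitz bound applies; those
outside the ball are farther from `x` than `z` is. -/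
theorem IsLipschitzChart.le_bdist {n : ℕ} {Ω : Set (RR n)} {R M : ℝ} {z e : RR n} {f : RR n → ℝ}
    (h : IsLipschitzChart Ω R M z e f) (hR : 0 < R) (hM : 1 ≤ M) (hz : z ∉ Ω) {x : RR n}
    (hx : ‖x - z‖ < R / 2) : f x / M ≤ bdist Ω x := by
  have hM0 : 0 < M := by linarith
  have hxR : x ∈ ball z R := by rw [mem_ball, dist_eq_norm]; linarith
  have hzR : z ∈ ball z R := mem_ball_self hR
  have key : ∀ q ∈ ball z R, q ∉ Ω → f x / M ≤ ‖x - q‖ := by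
    intro q hq hqΩ
    rw [h.mem_iff q hq, not_lt] at hqΩ
    rw [div_le_iff₀' hM0]
    linarith [h.lipschitz x hxR q hq]
  refine (le_infDist ⟨z, hz⟩).2 fun q hq => ?_
  rw [dist_eq_norm]
  by_cases hqR : q ∈ ball z R
  · exact key q hqR hq
  · have h1 := key z hzR hz
    have h2 : R ≤ ‖q - z‖ := by simpa [dist_eq_norm] using hqR
    have h3 := norm_sub_le_norm_sub_add_norm_sub q x z
    rw [norm_sub_rev q x] at h3
    linarith

/-! ### Taylor estimates and nondegeneracy for regularized distances. -/

section RegularizedDistance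

variable {n : ℕ} {α C : ℝ} {Ω : Set (RR n)} {ψ : RR n → ℝ}

theorem bdist_nonneg (Ω : Set (RR n)) (x : RR n) : 0 ≤ bdist Ω x := infDist_nonneg

theorem bdist_eq_zero {x : RR n} (hx : x ∉ Ω) : bdist Ω x = 0 := infDist_zero_of_mem hx

theorem IsRegularizedDistance.nonneg (h : IsRegularizedDistance α C Ω ψ) (x : RR n) : 0 ≤ ψ x :=
  (mul_nonneg (inv_nonneg.2 h.const_pos.le) (bdist_nonneg Ω x)).trans (h.lower x)

theorem IsRegularizedDistance.eq_zero (h : IsRegularizedDistance α C Ω ψ) {x : RR n} (hx : x ∉ Ω) :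
    ψ x = 0 :=
  le_antisymm (by simpa [bdist_eq_zero hx] using h.upper x) (h.nonneg x)

theorem IsRegularizedDistance.abs_apply_le (h : IsRegularizedDistance α C Ω ψ) (x : RR n) : |ψ x| ≤ C := by
  by_cases hx : x ∈ Ω
  · have h1 : (⨆ x ∈ Ω, ‖ψ x‖ₑ) ≤ ENNReal.ofReal C :=
      le_self_add.trans (le_self_add.trans h.norm_le)
    have h2 := (le_iSup₂ (f := fun x (_ : x ∈ Ω) => ‖ψ x‖ₑ) x hx).trans h1
    rwa [← ofReal_norm, ENNReal.ofReal_le_ofReal_iff h.const_pos.le] at h2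
  · rw [h.eq_zero hx, abs_zero]; exact h.const_pos.le

theorem IsRegularizedDistance.norm_fderiv_le (h : IsRegularizedDistance α C Ω ψ) {x : RR n}
    (hx : x ∈ Ω) : ‖fderiv ℝ ψ x‖ ≤ C := by
  have h1 : (⨆ x ∈ Ω, ‖fderiv ℝ ψ x‖ₑ) ≤ ENNReal.ofReal C :=
    le_add_self.trans (le_self_add.trans h.norm_le)
  have h2 := (le_iSup₂ (f := fun x (_ : x ∈ Ω) => ‖fderiv ℝ ψ x‖ₑ) x hx).trans h1
  rwa [← ofReal_norm, ENNReal.ofReal_le_ofReal_iff h.const_pos.le] at h2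

theorem IsRegularizedDistance.norm_fderiv_sub_le (h : IsRegularizedDistance α C Ω ψ) {x y : RR n}
    (hx : x ∈ Ω) (hy : y ∈ Ω) : ‖fderiv ℝ ψ x - fderiv ℝ ψ y‖ ≤ C * ‖x - y‖ ^ α := by
  rcases eq_or_ne x y with rfl | hxy
  · rw [sub_self, norm_zero]
    have := h.const_pos
    positivity
  · have h1 : (⨆ x ∈ Ω, ⨆ y ∈ Ω, ⨆ _ : x ≠ y,
        ENNReal.ofReal (‖fderiv ℝ ψ x - fderiv ℝ ψ y‖ / ‖x - y‖ ^ α)) ≤ ENNReal.ofReal C :=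
      le_add_self.trans h.norm_le
    simp only [iSup_le_iff] at h1
    have h2 := h1 x hx y hy hxy
    rw [ENNReal.ofReal_le_ofReal_iff h.const_pos.le] at h2
    have : 0 < ‖x - y‖ := norm_pos_iff.2 (sub_ne_zero.2 hxy)
    rwa [div_le_iff₀ (by positivity)] at h2

theorem IsRegularizedDistance.differentiableAt (h : IsRegularizedDistance α C Ω ψ) (hΩ : IsOpen Ω)
    {x : RR n} (hx : x ∈ Ω) : DifferentiableAt ℝ ψ x :=
  (h.contDiffOn.contDiffAt (hΩ.mem_nhds hx)).differentiableAt two_ne_zero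

theorem IsRegularizedDistance.one_le (h : IsRegularizedDistance α C Ω ψ) {x : RR n}
    (hx : 0 < bdist Ω x) : 1 ≤ C := by
  have h1 := (h.lower x).trans (h.upper x)
  have h2 := le_of_mul_le_mul_right h1 hx
  have := h.const_pos
  rw [inv_le_iff_one_le_mul₀ this] at h2
  nlinarith

theorem IsRegularizedDistance.abs_sub_sub_le_of_segment (h : IsRegularizedDistance α C Ω ψ)
    (hα : 0 < α) (hΩ : IsOpen Ω) {x₀ p q : RR n} (hx₀ : x₀ ∈ Ω) {r : ℝ}
    (hpq : segment ℝ p q ⊆ Ω ∩ closedBall x₀ r) :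
    |ψ q - ψ p - fderiv ℝ ψ x₀ (q - p)| ≤ C * r ^ α * ‖q - p‖ := by
  refine (convex_segment p q).norm_image_sub_le_of_norm_hasFDerivWithin_le'
    (fun x hx => (h.differentiableAt hΩ (hpq hx).1).hasFDerivAt.hasFDerivWithinAt)
    (fun x hx => (h.norm_fderiv_sub_le (hpq hx).1 hx₀).trans ?_)
    (left_mem_segment _ _ _) (right_mem_segment _ _ _)
  have h1 : ‖x - x₀‖ ≤ r := by simpa [dist_eq_norm] using (hpq hx).2
  have := h.const_pos
  gcongr

/-- The first order Taylor polynomial of `ψ` at `x₀`. -/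
noncomputable def linearization (ψ : RR n → ℝ) (x₀ x : RR n) : ℝ := ψ x₀ + fderiv ℝ ψ x₀ (x - x₀)

theorem continuous_linearization (ψ : RR n → ℝ) (x₀ : RR n) : Continuous (linearization ψ x₀) := by
  unfold linearization; fun_prop

theorem linearization_add (ψ : RR n → ℝ) (x₀ x v : RR n) :
    linearization ψ x₀ (x + v) = linearization ψ x₀ x + fderiv ℝ ψ x₀ v := by
  simp only [linearization]
  rw [add_sub_right_comm, map_add]
  ring

theorem rpow_one_add_eq_mul {r : ℝ} (hr : 0 ≤ r) (hα : 0 < α) : r ^ (1 + α) = r ^ α * r := by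
  rw [Real.rpow_one_add' hr (by linarith), mul_comm]

/-- The segment from `x₀` to `x` may leave Ω. The path that rises by `M * ‖x - x₀‖` along `e`,
crosses, and descends to `x` stays in Ω and has comparable length; the gradient is Hölder along it.
-/
theorem IsRegularizedDistance.abs_sub_linearization_le (h : IsRegularizedDistance α C Ω ψ)
    (hα : 0 < α) (hα1 : α < 1) (hΩ : IsOpen Ω) {R M : ℝ} (hM : 1 ≤ M) {z e : RR n} {f : RR n → ℝ}
    (hc : IsLipschitzChart Ω R M z e f) {x₀ x : RR n} (hx₀ : x₀ ∈ Ω) (hx : x ∈ Ω)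
    (hx₀z : ‖x₀ - z‖ < R / 4) (hxx₀ : 4 * M * ‖x - x₀‖ < R) :
    |ψ x - linearization ψ x₀ x| ≤ 6 * M ^ 2 * C * ‖x - x₀‖ ^ (1 + α) := by
  have hC := h.const_pos
  set r := ‖x - x₀‖ with hr
  have hr0 : 0 ≤ r := norm_nonneg _
  have hrM : r ≤ M * r := le_mul_of_one_le_left hr0 hM
  have hpt : ∀ θ ∈ Icc (0 : ℝ) 1, ∀ τ ∈ Icc (0 : ℝ) (M * r),
      0 < f (x₀ + θ • (x - x₀)) + τ →
      x₀ + θ • (x - x₀) + τ • e ∈ Ω ∩ closedBall x₀ (2 * M * r) := by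
    intro θ hθ τ hτ hf
    have hd : ‖x₀ + θ • (x - x₀) + τ • e - x₀‖ ≤ 2 * M * r := by
      have : x₀ + θ • (x - x₀) + τ • e - x₀ = θ • (x - x₀) + τ • e := by abel
      rw [this]
      refine (norm_add_le _ _).trans ?_
      rw [norm_smul, norm_smul, hc.norm_eq, Real.norm_of_nonneg hθ.1, Real.norm_of_nonneg hτ.1,
        ← hr]
      nlinarith [hθ.2, hτ.2]
    have hz : x₀ + θ • (x - x₀) + τ • e ∈ ball z R := by
      rw [mem_ball, dist_eq_norm]
      have := norm_sub_le_norm_sub_add_norm_sub (x₀ + θ • (x - x₀) + τ • e) x₀ z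
      linarith
    refine ⟨(hc.mem_iff _ hz).2 ?_, by rwa [mem_closedBall, dist_eq_norm]⟩
    rwa [hc.shift]
  have hx₀R : x₀ ∈ ball z R := by
    rw [mem_ball, dist_eq_norm]; linarith [norm_nonneg (x₀ - z)]
  have hxR : x ∈ ball z R := by
    rw [mem_ball, dist_eq_norm]
    have := norm_sub_le_norm_sub_add_norm_sub x x₀ z
    linarith
  have hfx₀ := (hc.mem_iff x₀ hx₀R).1 hx₀
  have hfx := (hc.mem_iff x hxR).1 hx
  have hMr : 0 ≤ M * r := by positivity
  set u : RR n := (M * r) • e with hu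
  have hun : ‖u‖ = M * r := by rw [hu, norm_smul, hc.norm_eq, mul_one, Real.norm_of_nonneg hMr]
  -- The three legs: up from `x₀`, up from `x`, and across at height `M * r`, where `f` is positive
  -- because it drops by at most `M * r` along the chord.
  have s1 := h.abs_sub_sub_le_of_segment hα hΩ hx₀ (p := x₀) (q := x₀ + u) (r := 2 * M * r) (by
    rw [segment_eq_image']
    rintro _ ⟨θ, hθ, rfl⟩
    have := hpt 0 (by simp) (θ * (M * r)) ⟨by have := hθ.1; positivity, by nlinarith [hθ.2]⟩ (by
      rw [zero_smul, add_zero]; have := hθ.1; positivity)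
    simpa [hu, smul_smul] using this)
  have s2 := h.abs_sub_sub_le_of_segment hα hΩ hx₀ (p := x) (q := x + u) (r := 2 * M * r) (by
    rw [segment_eq_image']
    rintro _ ⟨θ, hθ, rfl⟩
    have := hpt 1 (by simp) (θ * (M * r)) ⟨by have := hθ.1; positivity, by nlinarith [hθ.2]⟩ (by
      rw [one_smul, add_sub_cancel]; have := hθ.1; positivity)
    simpa [hu, smul_smul] using this)
  have s3 := h.abs_sub_sub_le_of_segment hα hΩ hx₀ (p := x₀ + u) (q := x + u) (r := 2 * M * r) (by
    rw [segment_eq_image']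
    rintro _ ⟨θ, hθ, rfl⟩
    have := hpt θ hθ (M * r) ⟨hMr, le_rfl⟩ (by
      have hy : x₀ + θ • (x - x₀) ∈ ball z R := by
        rw [mem_ball, dist_eq_norm, add_sub_right_comm]
        refine (norm_add_le _ _).trans_lt ?_
        rw [norm_smul, Real.norm_of_nonneg hθ.1, ← hr]
        nlinarith [hθ.2]
      have := hc.lipschitz x₀ hx₀R _ hy
      rw [sub_add_cancel_left, norm_neg, norm_smul, Real.norm_of_nonneg hθ.1, ← hr] at this
      have h2 : M * (θ * r) ≤ M * r := by gcongr; nlinarith [hθ.2]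
      linarith)
    have e1 : x₀ + u + θ • (x + u - (x₀ + u)) = x₀ + θ • (x - x₀) + (M * r) • e := by
      rw [add_sub_add_right_eq_sub, hu]; abel
    simpa only [e1] using this)
  rw [add_sub_cancel_left, hun] at s1 s2
  rw [add_sub_add_right_eq_sub, ← hr] at s3
  have hpow : (2 * M * r) ^ α ≤ 2 * M * r ^ α := by
    rw [Real.mul_rpow (by linarith) hr0]
    gcongr
    have := Real.rpow_le_rpow_of_exponent_le (show 1 ≤ 2 * M by linarith) hα1.le
    rwa [Real.rpow_one] at this
  rw [rpow_one_add_eq_mul hr0 hα, linearization]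
  have hfin : C * (2 * M * r) ^ α * (M * r) + C * (2 * M * r) ^ α * r + C * (2 * M * r) ^ α * (M * r)
      ≤ 6 * M ^ 2 * C * (r ^ α * r) := by
    calc _ = C * (2 * M * r) ^ α * ((2 * M + 1) * r) := by ring
      _ ≤ C * (2 * M * r ^ α) * ((3 * M) * r) := by gcongr; linarith
      _ = _ := by ring
  rw [abs_le] at s1 s2 s3 ⊢
  constructor <;> linarith [s1.1, s1.2, s2.1, s2.2, s3.1, s3.2]

/-- Move from `x` along `e` to just inside Ω, where ψ is tiny and the Taylor estimate applies, then
return along ℓ. The return is harmless because the slope of ℓ along `e` cannot be very negative: ψ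
is nonnegative further up. -/
theorem IsRegularizedDistance.linearization_le_of_notMem (h : IsRegularizedDistance α C Ω ψ)
    (hα : 0 < α) (hα1 : α < 1) (hΩ : IsOpen Ω) {R M : ℝ} (hR1 : R ≤ 1) (hM : 1 ≤ M) {z e : RR n}
    {f : RR n → ℝ} (hc : IsLipschitzChart Ω R M z e f) {x₀ x : RR n} (hx₀ : x₀ ∈ Ω) (hx : x ∉ Ω)
    (hx₀z : ‖x₀ - z‖ < R / 4) (hxx₀ : 16 * M ^ 2 * ‖x - x₀‖ < R) :
    linearization ψ x₀ x ≤ 500 * M ^ 5 * C * ‖x - x₀‖ ^ (1 + α) := by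
  have hC := h.const_pos
  set r := ‖x - x₀‖ with hr
  have hr0 : 0 < r := norm_pos_iff.2 (sub_ne_zero.2 fun hxx => hx (hxx ▸ hx₀))
  have hrM : r ≤ M * r := le_mul_of_one_le_left hr0.le hM
  have hMM : M * r ≤ M ^ 2 * r := by nlinarith
  have hr1 : r ≤ 1 := by linarith
  set t := r ^ (1 + α) with ht
  have ht0 : 0 < t := by positivity
  have htr : t ≤ r := by
    have := Real.rpow_le_rpow_of_exponent_ge hr0 hr1 (show (1 : ℝ) ≤ 1 + α by linarith)
    rwa [Real.rpow_one] at this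
  have hx₀R : x₀ ∈ ball z R := by
    rw [mem_ball, dist_eq_norm]; linarith [norm_nonneg (x₀ - z)]
  have hxR : x ∈ ball z R := by
    rw [mem_ball, dist_eq_norm]
    have := norm_sub_le_norm_sub_add_norm_sub x x₀ z
    linarith
  have hfx₀ := (hc.mem_iff x₀ hx₀R).1 hx₀
  have hfx : f x ≤ 0 := not_lt.1 fun hlt => hx ((hc.mem_iff x hxR).2 hlt)
  have hfM : -f x ≤ M * r := by
    have := hc.lipschitz x₀ hx₀R x hxR
    rw [norm_sub_rev, ← hr] at this
    linarith
  have hd : ∀ τ : ℝ, 0 ≤ τ → τ ≤ M * r + 2 * r → ‖x + τ • e - x₀‖ ≤ 4 * M * r := by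
    intro τ h0 h1
    rw [add_sub_right_comm]
    refine (norm_add_le _ _).trans ?_
    rw [norm_smul, hc.norm_eq, Real.norm_of_nonneg h0, ← hr]
    linarith
  have hball : ∀ τ : ℝ, 0 ≤ τ → τ ≤ M * r + 2 * r → x + τ • e ∈ ball z R := by
    intro τ h0 h1
    rw [mem_ball, dist_eq_norm]
    have := norm_sub_le_norm_sub_add_norm_sub (x + τ • e) x₀ z
    linarith [hd τ h0 h1]
  have hlin : ∀ τ : ℝ, -f x < τ → τ ≤ M * r + 2 * r →
      |ψ (x + τ • e) - linearization ψ x₀ (x + τ • e)| ≤ 96 * M ^ 4 * C * t := by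
    intro τ h0 h1
    have hmem : x + τ • e ∈ Ω := (hc.mem_iff _ (hball τ (by linarith) h1)).2 (by
      rw [hc.shift]; linarith)
    have hdτ := hd τ (by linarith) h1
    refine (h.abs_sub_linearization_le hα hα1 hΩ hM hc hx₀ hmem hx₀z ?_).trans ?_
    · calc 4 * M * ‖x + τ • e - x₀‖ ≤ 4 * M * (4 * M * r) := by gcongr
        _ = 16 * M ^ 2 * r := by ring
        _ < R := hxx₀
    · calc 6 * M ^ 2 * C * ‖x + τ • e - x₀‖ ^ (1 + α) ≤ 6 * M ^ 2 * C * (4 * M * r) ^ (1 + α) := by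
            gcongr
        _ = 6 * M ^ 2 * C * ((4 * M) ^ (1 + α) * t) := by
            rw [Real.mul_rpow (by linarith) hr0.le]
        _ ≤ 6 * M ^ 2 * C * ((4 * M) ^ (2 : ℝ) * t) := by
            gcongr
            · linarith
            · linarith
        _ = _ := by rw [Real.rpow_two]; ring
  -- The shift by `-f x` reaches the boundary level. The extra height `t = r ^ (1 + α)` puts the
  -- point inside Ω and keeps ψ there of the order of the Taylor error.
  set τ₁ := -f x + t
  have hp1 := hlin τ₁ (by simp only [τ₁]; linarith) (by simp only [τ₁]; linarith)
  have hp2 := hlin (τ₁ + r) (by simp only [τ₁]; linarith) (by simp only [τ₁]; linarith)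
  have hψ1 : ψ (x + τ₁ • e) ≤ C * t := by
    refine (h.upper _).trans ?_
    gcongr
    have hq : x + (-f x) • e ∉ Ω := by
      rw [hc.mem_iff _ (hball _ (by linarith) (by linarith)), hc.shift]
      simp
    refine (infDist_le_dist_of_mem (s := Ωᶜ) hq).trans (le_of_eq ?_)
    rw [dist_eq_norm, add_sub_add_left_eq_sub, ← sub_smul, norm_smul, hc.norm_eq]
    simp [τ₁, abs_of_pos ht0]
  have hψ2 := h.nonneg (x + (τ₁ + r) • e)
  simp only [linearization_add, map_smul, smul_eq_mul] at hp1 hp2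
  rw [abs_le] at hp1 hp2
  set G := fderiv ℝ ψ x₀ e
  have hM4 : 1 ≤ M ^ 4 := one_le_pow₀ hM
  -- Compare ℓ at heights `τ₁` and `τ₁ + r`: two Taylor errors of `96 * M ^ 4 * C * t`, plus `ψ ≤ C
  -- * t` below and `ψ ≥ 0` above.
  have hrG : -(193 * M ^ 4 * C * t) ≤ r * G := by
    have : C * t ≤ M ^ 4 * (C * t) := le_mul_of_one_le_left (by positivity) hM4
    nlinarith [hp1.1, hp2.2]
  have hτ : -τ₁ * G ≤ 386 * M ^ 5 * C * t := by
    have h1 : τ₁ ≤ 2 * M * r := by simp only [τ₁]; linarith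
    have h2 : 0 ≤ τ₁ := by simp only [τ₁]; linarith
    rcases le_total 0 G with hG | hG
    · have : 0 ≤ τ₁ * G := by positivity
      have : 0 ≤ 386 * M ^ 5 * C * t := by positivity
      linarith
    · calc -τ₁ * G = τ₁ * (-G) := by ring
        _ ≤ 2 * M * r * (-G) := by gcongr; linarith
        _ = 2 * M * (-(r * G)) := by ring
        _ ≤ 2 * M * (193 * M ^ 4 * C * t) := by gcongr; linarith
        _ = _ := by ring
  have hM5 : M ^ 4 * (C * t) ≤ M ^ 5 * (C * t) := by
    gcongr
    norm_num
  have : C * t ≤ M ^ 4 * (C * t) := le_mul_of_one_le_left (by positivity) hM4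
  nlinarith [hp1.1, hp1.2]

/-- On the ball of half the distance to the complement the distance stays at least that half, so the
Hessian bound is uniform there, the exponent `α - 1` being negative. -/
theorem IsRegularizedDistance.abs_sub_linearization_le_sq (h : IsRegularizedDistance α C Ω ψ)
    (hα1 : α < 1) (hΩ : IsOpen Ω) {x₀ y : RR n} (hx₀ : 0 < bdist Ω x₀)
    (hy : ‖y‖ < bdist Ω x₀ / 2) :
    bdist Ω x₀ / 2 ≤ bdist Ω (x₀ + y) ∧
    |ψ (x₀ + y) - linearization ψ x₀ (x₀ + y)| ≤ C * (bdist Ω x₀ / 2) ^ (α - 1) * ‖y‖ ^ 2 := by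
  have hC := h.const_pos
  set ρ := bdist Ω x₀ with hρ
  have hd : ∀ x ∈ ball x₀ (ρ / 2), ρ / 2 ≤ bdist Ω x := by
    intro x hx
    have h1 : ρ ≤ bdist Ω x + dist x₀ x := infDist_le_infDist_add_dist
    rw [mem_ball, dist_comm] at hx
    linarith
  have hmem : ∀ x ∈ ball x₀ (ρ / 2), x ∈ Ω := by
    intro x hx
    by_contra hxΩ
    have := hd x hx
    rw [bdist_eq_zero hxΩ] at this
    linarith
  have hx0b : x₀ ∈ ball x₀ (ρ / 2) := mem_ball_self (by linarith)
  have hxy : x₀ + y ∈ ball x₀ (ρ / 2) := by simpa [dist_eq_norm] using hy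
  refine ⟨hd _ hxy, ?_⟩
  have hlip : ∀ x ∈ ball x₀ (ρ / 2), ‖fderiv ℝ ψ x - fderiv ℝ ψ x₀‖ ≤
      C * (ρ / 2) ^ (α - 1) * ‖x - x₀‖ := by
    intro x hx
    refine (convex_ball x₀ (ρ / 2)).norm_image_sub_le_of_norm_fderiv_le (𝕜 := ℝ)
      (f := fderiv ℝ ψ) (fun w hw => ?_) (fun w hw => ?_) hx0b hx
    · exact ((h.contDiffOn.contDiffAt (hΩ.mem_nhds (hmem w hw))).fderiv_right (m := 1)
        (by norm_num)).differentiableAt one_ne_zero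
    · have h1 := h.hessian_le w (hmem w hw)
      have h2 : ‖iteratedFDeriv ℝ 2 ψ w‖ = ‖fderiv ℝ (fderiv ℝ ψ) w‖ := by
        rw [← norm_iteratedFDeriv_fderiv, ← norm_iteratedFDeriv_fderiv, norm_iteratedFDeriv_zero]
      rw [h2] at h1
      refine h1.trans ?_
      gcongr C * ?_
      exact Real.rpow_le_rpow_of_nonpos (by linarith) (hd w hw) (by linarith)
  have hseg : segment ℝ x₀ (x₀ + y) ⊆ ball x₀ (ρ / 2) :=
    (convex_ball x₀ (ρ / 2)).segment_subset hx0b hxy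
  have key := (convex_segment x₀ (x₀ + y)).norm_image_sub_le_of_norm_hasFDerivWithin_le'
    (f := ψ) (φ := fderiv ℝ ψ x₀) (C := C * (ρ / 2) ^ (α - 1) * ‖y‖)
    (fun x hx => (h.differentiableAt hΩ (hmem x (hseg hx))).hasFDerivAt.hasFDerivWithinAt)
    (fun x hx => (hlip x (hseg hx)).trans ?_)
    (left_mem_segment _ _ _) (right_mem_segment _ _ _)
  · rw [Real.norm_eq_abs, add_sub_cancel_left] at key
    rw [linearization, add_sub_cancel_left, ← sub_sub]
    refine key.trans (le_of_eq (by ring))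
  · rw [segment_eq_image'] at hx
    obtain ⟨θ, hθ, rfl⟩ := hx
    rw [add_sub_cancel_left, add_sub_cancel_left, norm_smul, Real.norm_of_nonneg hθ.1]
    gcongr
    exact mul_le_of_le_one_left (norm_nonneg _) hθ.2

/-- Going from `x₀` towards its nearest point `z`, ψ falls from at least `ρ / C` to almost zero over
a length at most ρ. Since the Taylor error is of smaller order, the derivative along `x₀ - z` is at
least `ρ / (2 * C)`. -/
theorem IsRegularizedDistance.exists_fderiv_eq_one (h : IsRegularizedDistance α C Ω ψ)
    (hα : 0 < α) (hΩ : IsOpen Ω) {x₀ z : RR n} (hx₀ : x₀ ∈ Ω) (hρ : 0 < bdist Ω x₀)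
    (hz : z ∉ Ω) (hxz : bdist Ω x₀ = ‖x₀ - z‖) (hsmall : 4 * C ^ 2 * bdist Ω x₀ ^ α ≤ 1) :
    ∃ v, ‖v‖ ≤ 2 * C ∧ fderiv ℝ ψ x₀ v = 1 := by
  have hC := h.const_pos
  have hC1 := h.one_le hρ
  set ρ := bdist Ω x₀ with hρdef
  set δ := ρ ^ α with hδ
  have hδ0 : 0 < δ := by positivity
  have hδ1 : δ ≤ 1 / 4 := by
    have : 1 * δ ≤ C ^ 2 * δ := by gcongr; exact one_le_pow₀ hC1
    linarith
  have hball : ball x₀ ρ ⊆ Ω := by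
    intro x hx
    by_contra hxΩ
    have := infDist_le_dist_of_mem (x := x₀) (s := Ωᶜ) hxΩ
    rw [mem_ball, dist_comm] at hx
    exact absurd hx (not_lt.2 this)
  set G := fderiv ℝ ψ x₀ (x₀ - z) with hG
  set p := x₀ + (1 - δ) • (z - x₀) with hp
  have hpx : ‖p - x₀‖ = (1 - δ) * ρ := by
    rw [hp, add_sub_cancel_left, norm_smul, norm_sub_rev z, ← hxz, Real.norm_of_nonneg (by linarith)]
  have hpρ : p ∈ ball x₀ ρ := by rw [mem_ball, dist_eq_norm, hpx]; nlinarith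
  have hseg := h.abs_sub_sub_le_of_segment hα hΩ hx₀ (p := x₀) (q := p) (r := ρ) (by
    have h1 := (convex_ball x₀ ρ).segment_subset (mem_ball_self hρ) hpρ
    exact fun x hx => ⟨hball (h1 hx), ball_subset_closedBall (h1 hx)⟩)
  have hpz : ψ p ≤ C * (δ * ρ) := by
    refine (h.upper p).trans ?_
    gcongr
    refine (infDist_le_dist_of_mem (s := Ωᶜ) hz).trans (le_of_eq ?_)
    have : p - z = δ • (x₀ - z) := by rw [hp, sub_smul, one_smul, smul_sub, smul_sub]; abel
    rw [dist_eq_norm, this, norm_smul, ← hxz, Real.norm_of_nonneg hδ0.le]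
  have hpG : fderiv ℝ ψ x₀ (p - x₀) = -((1 - δ) * G) := by
    rw [hp, add_sub_cancel_left, map_smul, smul_eq_mul, hG, ← neg_sub x₀ z, map_neg]; ring
  rw [hpG, hpx, abs_le] at hseg
  have hlow := h.lower x₀
  rw [← hρdef] at hlow
  have hGt : ρ / (2 * C) ≤ (1 - δ) * G := by
    have h1 : C * δ * ((1 - δ) * ρ) ≤ C * δ * ρ := by
      gcongr
      nlinarith
    have h2 : 2 * (C * δ * ρ) ≤ ρ / (2 * C) := by
      rw [le_div_iff₀ (by positivity)]
      calc 2 * (C * δ * ρ) * (2 * C) = 4 * C ^ 2 * δ * ρ := by ring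
        _ ≤ 1 * ρ := by gcongr
        _ = ρ := one_mul ρ
    have h3 : C⁻¹ * ρ = ρ / (2 * C) + ρ / (2 * C) := by field_simp; ring
    nlinarith [hseg.1]
  have hpos : 0 < ρ / (2 * C) := by positivity
  have hG0 : 0 < G := by
    by_contra hneg
    nlinarith
  have hGρ : ρ / (2 * C) ≤ G := by nlinarith
  refine ⟨G⁻¹ • (x₀ - z), ?_, ?_⟩
  · rw [norm_smul, ← hxz, norm_inv, Real.norm_of_nonneg hG0.le, inv_mul_le_iff₀ hG0]
    rw [div_le_iff₀ (by positivity)] at hGρ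
    linarith
  · rw [map_smul, smul_eq_mul, inv_mul_cancel₀ hG0.ne']

end RegularizedDistance

/-! ### The error of linearizing before taking the power. -/

/-- Write `a ^ s = a * a ^ (s - 1)` and use that `t ^ (s - 1)` decreases. The weight involves `a`
alone, so `b`, later the positive part of ℓ, may vanish. -/
theorem abs_rpow_sub_rpow_le {s a b : ℝ} (hs1 : s < 1) (hs : 0 < s) (ha : 0 < a) (hb : 0 ≤ b) :
    |a ^ s - b ^ s| ≤ |a - b| * a ^ (s - 1) := by
  have key : ∀ a b : ℝ, 0 < a → 0 ≤ b → b ≤ a → a ^ s - b ^ s ≤ (a - b) * a ^ (s - 1) := by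
    intro a b ha hb hab
    have h1 : a ^ s = a * a ^ (s - 1) := by rw [← Real.rpow_one_add' ha.le (by linarith)]; congr 1; ring
    rcases hb.eq_or_lt with rfl | hb0
    · rw [Real.zero_rpow hs.ne', h1]; simp
    · have h2 : b ^ s = b * b ^ (s - 1) := by
        rw [← Real.rpow_one_add' hb (by linarith)]; congr 1; ring
      have h3 : a ^ (s - 1) ≤ b ^ (s - 1) := Real.rpow_le_rpow_of_nonpos hb0 hab (by linarith)
      rw [h1, h2]
      nlinarith
  rcases le_total b a with h | h
  · rw [abs_of_nonneg (sub_nonneg.2 (Real.rpow_le_rpow hb h hs.le)), abs_of_nonneg (sub_nonneg.2 h)]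
    exact key a b ha hb h
  · rw [abs_sub_comm, abs_sub_comm a, abs_of_nonneg (sub_nonneg.2 (Real.rpow_le_rpow ha.le h hs.le)),
      abs_of_nonneg (sub_nonneg.2 h)]
    exact (key b a (ha.trans_le h) ha.le h).trans (mul_le_mul_of_nonneg_left
      (Real.rpow_le_rpow_of_nonpos ha h (by linarith)) (sub_nonneg.2 h))

/-- The measure with density `g₊ ^ (s - 1)` gives balls of radius `r` mass of order `r ^ (n + s -
1)`. The layer cake bound converges because the decay exponent exceeds this by `s - α > 0`. -/
theorem setLIntegral_compl_ball_max_rpow_mul_le {n : ℕ} [NeZero n] {s α m η : ℝ} (hs : 0 < s)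
    (hs1 : s < 1) (hαs : α < s) (hη : 0 < η) {g : RR n → ℝ} (hg : Measurable g)
    {v : RR n} (hv : ‖v‖ ≤ m) (hgv : ∀ x (τ : ℝ), g (x + τ • v) = g x + τ) :
    ∫⁻ y in (ball (0 : RR n) η)ᶜ,
      ENNReal.ofReal (max (g y) 0 ^ (s - 1) * ‖y‖ ^ (-((n : ℝ) + 2 * s - 1 - α))) ≤
      ENNReal.ofReal (volume.real (ball (0 : RR n) 1) * ((1 + m) ^ n / s) *
        (((n : ℝ) + 2 * s - 1 - α) / (s - α)) * η ^ (α - s)) := by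
  have hn : (1 : ℝ) ≤ n := by exact_mod_cast Nat.pos_of_neZero n
  have hm : 0 ≤ m := (norm_nonneg v).trans hv
  have hsα : 0 < s - α := by linarith
  have hβ : 0 < (n : ℝ) + 2 * s - 1 - α := by linarith
  have hFm : Measurable fun y => ENNReal.ofReal (max (g y) 0 ^ (s - 1)) := by fun_prop
  set V := volume.real (ball (0 : RR n) 1) with hV
  have hVe : volume (ball (0 : RR n) 1) = ENNReal.ofReal V :=
    (ENNReal.ofReal_toReal measure_ball_lt_top.ne).symm
  have hV0 : 0 ≤ V := measureReal_nonneg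
  let μ : Measure (RR n) := volume.withDensity fun y => ENNReal.ofReal (max (g y) 0 ^ (s - 1))
  have hμ : ∀ r, η < r → μ (ball 0 r) ≤
      ENNReal.ofReal (V * ((1 + m) ^ n / s)) * ENNReal.ofReal (r ^ ((n : ℝ) + s - 1)) := by
    intro r hr
    have hr0 : 0 < r := hη.trans hr
    rw [withDensity_apply _ measurableSet_ball]
    refine (setLIntegral_ball_max_rpow_le volume hs hs1 hr0 hg hv hgv 0).trans (le_of_eq ?_)
    rw [Measure.addHaar_ball _ _ (by positivity), finrank_euclideanSpace_fin, hVe,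
      ← ENNReal.ofReal_mul (by positivity), ← ENNReal.ofReal_mul (by positivity),
      ← ENNReal.ofReal_mul (by positivity)]
    congr 1
    have : r ^ ((n : ℝ) + s - 1) = r ^ n * r ^ (s - 1) := by
      rw [← Real.rpow_natCast, ← Real.rpow_add hr0]; congr 1; ring
    rw [this, mul_pow]
    ring
  have h := setLIntegral_compl_ball_norm_rpow_neg_le μ hη hβ (by linarith) hμ
  rw [setLIntegral_withDensity_eq_setLIntegral_mul _ hFm (by fun_prop) measurableSet_ball.compl,
    ← ENNReal.ofReal_mul (by positivity)] at h
  have e1 : (n : ℝ) + 2 * s - 1 - α - ((n : ℝ) + s - 1) = s - α := by ring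
  have e2 : (n : ℝ) + s - 1 - ((n : ℝ) + 2 * s - 1 - α) = α - s := by ring
  rw [e1, e2] at h
  refine (lintegral_congr fun y => ?_).trans_le (h.trans (le_of_eq ?_))
  · rw [Pi.mul_apply, ENNReal.ofReal_mul (by positivity)]
  · congr 1; ring

section Error

variable {n : ℕ} {s α C : ℝ} {Ω : Set (RR n)} {ψ : RR n → ℝ}

/-- The difference at `x₀ + y` between `ψ ^ s` and the power of the positive part of the
linearization of `ψ` at `x₀`. -/
noncomputable def linearizationError (s : ℝ) (ψ : RR n → ℝ) (x₀ y : RR n) : ℝ :=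
  ψ (x₀ + y) ^ s - max (linearization ψ x₀ (x₀ + y)) 0 ^ s

theorem IsRegularizedDistance.measurable (h : IsRegularizedDistance α C Ω ψ) (hΩ : IsOpen Ω) :
    Measurable ψ := by
  classical
  have : Ω.piecewise ψ (fun _ => 0) = ψ := by
    ext x
    by_cases hx : x ∈ Ω
    · simp [hx]
    · simp [hx, h.eq_zero hx]
  rw [← this]
  exact h.contDiffOn.continuousOn.measurable_piecewise continuousOn_const hΩ.measurableSet

theorem IsRegularizedDistance.measurable_linearizationError (h : IsRegularizedDistance α C Ω ψ)
    (hΩ : IsOpen Ω) (s : ℝ) (x₀ : RR n) : Measurable (linearizationError s ψ x₀) := by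
  unfold linearizationError
  have h1 := h.measurable hΩ
  have h2 := (continuous_linearization ψ x₀).measurable
  fun_prop

theorem IsRegularizedDistance.abs_linearizationError_le (h : IsRegularizedDistance α C Ω ψ)
    (hs : 0 < s) (hs1 : s < 1) {x₀ y : RR n} (hpos : 0 < ψ (x₀ + y)) :
    |linearizationError s ψ x₀ y| ≤
      |ψ (x₀ + y) - linearization ψ x₀ (x₀ + y)| * ψ (x₀ + y) ^ (s - 1) := by
  refine (abs_rpow_sub_rpow_le hs1 hs hpos (le_max_right _ _)).trans ?_
  have := abs_max_sub_max_le_abs (ψ (x₀ + y)) (linearization ψ x₀ (x₀ + y)) 0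
  rw [max_eq_left (h.nonneg _)] at this
  exact mul_le_mul_of_nonneg_right this (Real.rpow_nonneg hpos.le _)

theorem IsRegularizedDistance.abs_linearizationError_le_sq (h : IsRegularizedDistance α C Ω ψ)
    (hα1 : α < 1) (hΩ : IsOpen Ω) (hs : 0 < s) (hs1 : s < 1) {x₀ y : RR n}
    (hx₀ : 0 < bdist Ω x₀) (hy : ‖y‖ < bdist Ω x₀ / 2) :
    |linearizationError s ψ x₀ y| ≤ C ^ (2 - s) * (bdist Ω x₀ / 2) ^ (α + s - 2) * ‖y‖ ^ 2 := by
  have hC := h.const_pos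
  obtain ⟨h1, h2⟩ := h.abs_sub_linearization_le_sq hα1 hΩ hx₀ hy
  set δ := bdist Ω x₀ / 2
  have hδ : 0 < δ := by simp only [δ]; linarith
  have h3 : C⁻¹ * δ ≤ ψ (x₀ + y) := le_trans (by gcongr) (h.lower (x₀ + y))
  have h4 : 0 < C⁻¹ * δ := by positivity
  refine (h.abs_linearizationError_le hs hs1 (h4.trans_le h3)).trans ?_
  calc _ ≤ (C * δ ^ (α - 1) * ‖y‖ ^ 2) * (C⁻¹ * δ) ^ (s - 1) := by
        exact mul_le_mul h2 (Real.rpow_le_rpow_of_nonpos h4 h3 (by linarith))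
          (Real.rpow_nonneg (h4.le.trans h3) _) (by positivity)
    _ = _ := by
        rw [Real.mul_rpow (by positivity) hδ.le, Real.inv_rpow hC.le, ← Real.rpow_neg hC.le]
        have e1 : C ^ (2 - s) = C * C ^ (-(s - 1)) := by
          rw [← Real.rpow_one_add' hC.le (by linarith)]; congr 1; ring
        have e2 : δ ^ (α + s - 2) = δ ^ (α - 1) * δ ^ (s - 1) := by
          rw [← Real.rpow_add hδ]; congr 1; ring
        rw [e1, e2]
        ring

theorem IsRegularizedDistance.abs_linearizationError_le_rpow (h : IsRegularizedDistance α C Ω ψ)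
    (hs : 0 < s) {x₀ y : RR n} (hx₀ : x₀ ∈ Ω) {η : ℝ} (hη : 0 < η) (hy : η ≤ ‖y‖) :
    |linearizationError s ψ x₀ y| ≤ (C * (1 + η⁻¹)) ^ s * ‖y‖ ^ s := by
  have hC := h.const_pos
  have hy0 : 0 ≤ ‖y‖ := norm_nonneg y
  have h1 : 1 + ‖y‖ ≤ (1 + η⁻¹) * ‖y‖ := by
    have : 1 ≤ η⁻¹ * ‖y‖ := by rwa [← div_eq_inv_mul, one_le_div hη]
    linarith
  have hCy : C ≤ C * (1 + ‖y‖) := le_mul_of_one_le_right hC.le (by linarith)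
  have h2 : ψ (x₀ + y) ≤ C * (1 + ‖y‖) := (le_abs_self _).trans ((h.abs_apply_le _).trans hCy)
  have h3 : max (linearization ψ x₀ (x₀ + y)) 0 ≤ C * (1 + ‖y‖) := by
    refine max_le ?_ (by positivity)
    rw [linearization, add_sub_cancel_left]
    have a1 := (le_abs_self _).trans (h.abs_apply_le x₀)
    have a2 := (le_abs_self _).trans ((fderiv ℝ ψ x₀).le_of_opNorm_le (h.norm_fderiv_le hx₀) y)
    linarith
  have h4 : (C * (1 + ‖y‖)) ^ s ≤ (C * (1 + η⁻¹)) ^ s * ‖y‖ ^ s := by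
    rw [← Real.mul_rpow (by positivity) hy0, mul_assoc C]
    gcongr
  refine le_trans ?_ h4
  have b1 := Real.rpow_le_rpow (h.nonneg _) h2 hs.le
  have b2 := Real.rpow_le_rpow (le_max_right _ _) h3 hs.le
  have b3 : 0 ≤ ψ (x₀ + y) ^ s := Real.rpow_nonneg (h.nonneg _) _
  have b4 : 0 ≤ max (linearization ψ x₀ (x₀ + y)) 0 ^ s := by positivity
  rw [linearizationError, abs_le]
  constructor <;> linarith

/-- Inside Ω the weight `ψ ^ (s - 1)` is controlled through `ψ ≥ f / (C * M)`. Outside, ψ vanishes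
and the error is `ℓ₊ * ℓ₊ ^ (s - 1)` in absolute value, with `ℓ₊` bounded by the Taylor order. -/
theorem IsRegularizedDistance.abs_linearizationError_le_of_chart
    (h : IsRegularizedDistance α C Ω ψ) (hα : 0 < α) (hα1 : α < 1) (hΩ : IsOpen Ω) (hs : 0 < s)
    (hs1 : s < 1) {R M : ℝ} (hR : 0 < R) (hR1 : R ≤ 1) (hM : 1 ≤ M) {z e : RR n} (hz : z ∉ Ω)
    {f : RR n → ℝ} (hc : IsLipschitzChart Ω R M z e f) {x₀ y : RR n} (hx₀ : x₀ ∈ Ω)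
    (hρ : 0 < bdist Ω x₀) (hx₀z : ‖x₀ - z‖ < R / 4) (hy : 16 * M ^ 2 * ‖y‖ < R) :
    |linearizationError s ψ x₀ y| ≤ 500 * M ^ 5 * C ^ 2 * ‖y‖ ^ (1 + α) *
      (max (f (x₀ + y)) 0 ^ (s - 1) + max (linearization ψ x₀ (x₀ + y)) 0 ^ (s - 1)) := by
  have hC := h.const_pos
  have hC1 := h.one_le hρ
  have hnn1 : 0 ≤ max (f (x₀ + y)) 0 ^ (s - 1) := by positivity
  have hnn2 : 0 ≤ max (linearization ψ x₀ (x₀ + y)) 0 ^ (s - 1) := by positivity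
  have hyy : ‖y‖ ≤ M ^ 2 * ‖y‖ := le_mul_of_one_le_left (norm_nonneg _) (one_le_pow₀ hM)
  have hMy : M * ‖y‖ ≤ M ^ 2 * ‖y‖ := by gcongr; exact le_self_pow₀ hM two_ne_zero
  have hxz : ‖x₀ + y - z‖ < R / 2 := by
    rw [add_sub_right_comm]
    linarith [norm_add_le (x₀ - z) y, norm_nonneg y]
  by_cases hx : x₀ + y ∈ Ω
  · have hf : 0 < f (x₀ + y) :=
      (hc.mem_iff _ (by rw [mem_ball, dist_eq_norm]; linarith)).1 hx
    have h1 := h.abs_sub_linearization_le hα hα1 hΩ hM hc hx₀ hx hx₀z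
      (by rw [add_sub_cancel_left]; linarith [norm_nonneg y])
    rw [add_sub_cancel_left] at h1
    have h2 : (C * M)⁻¹ * f (x₀ + y) ≤ ψ (x₀ + y) := by
      refine le_trans ?_ (h.lower _)
      rw [mul_inv, mul_assoc, inv_mul_eq_div M]
      gcongr
      exact hc.le_bdist hR hM hz hxz
    have h3 : 0 < (C * M)⁻¹ * f (x₀ + y) := by positivity
    have hCM : 1 ≤ C * M := one_le_mul_of_one_le_of_one_le hC1 hM
    have h4 : ψ (x₀ + y) ^ (s - 1) ≤ C * M * f (x₀ + y) ^ (s - 1) := by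
      refine (Real.rpow_le_rpow_of_nonpos h3 h2 (by linarith)).trans ?_
      rw [Real.mul_rpow (by positivity) hf.le, Real.inv_rpow (by positivity),
        ← Real.rpow_neg (by positivity)]
      gcongr
      have := Real.rpow_le_rpow_of_exponent_le hCM (show -(s - 1) ≤ 1 by linarith)
      rwa [Real.rpow_one] at this
    refine (h.abs_linearizationError_le hs hs1 (h3.trans_le h2)).trans ?_
    rw [max_eq_left hf.le]
    rw [max_eq_left hf.le] at hnn1
    calc _ ≤ 6 * M ^ 2 * C * ‖y‖ ^ (1 + α) * (C * M * f (x₀ + y) ^ (s - 1)) :=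
          mul_le_mul h1 h4 (Real.rpow_nonneg (h.nonneg _) _) (by positivity)
      _ = 6 * M ^ 3 * C ^ 2 * ‖y‖ ^ (1 + α) * f (x₀ + y) ^ (s - 1) := by ring
      _ ≤ 500 * M ^ 5 * C ^ 2 * ‖y‖ ^ (1 + α) * (f (x₀ + y) ^ (s - 1) +
          max (linearization ψ x₀ (x₀ + y)) 0 ^ (s - 1)) := by
        gcongr ?_ * _ * _ * ?_
        · have : M ^ 3 ≤ M ^ 5 := pow_le_pow_right₀ hM (by norm_num)
          have : 0 ≤ M ^ 5 := by positivity
          linarith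
        · linarith
  · have h1 := h.linearization_le_of_notMem hα hα1 hΩ hR1 hM hc hx₀ hx hx₀z
      (by rwa [add_sub_cancel_left])
    rw [add_sub_cancel_left] at h1
    rw [linearizationError, h.eq_zero hx, Real.zero_rpow hs.ne', zero_sub, abs_neg,
      abs_of_nonneg (by positivity)]
    set l := linearization ψ x₀ (x₀ + y)
    have h2 : max l 0 ^ s = max l 0 * max l 0 ^ (s - 1) := by
      rw [← Real.rpow_one_add' (le_max_right _ _) (by linarith)]; congr 1; ring
    have h3 : max l 0 ≤ 500 * M ^ 5 * C ^ 2 * ‖y‖ ^ (1 + α) := by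
      refine max_le (h1.trans ?_) (by positivity)
      gcongr
      exact le_self_pow₀ hC1 two_ne_zero
    rw [h2]
    gcongr
    linarith

end Error

theorem setLIntegral_union_le_ofReal {X : Type*} [MeasurableSpace X] {μ : Measure X} {F : X → ℝ≥0∞}
    {S T : Set X} {a b : ℝ} (ha : 0 ≤ a) (hb : 0 ≤ b) (hS : ∫⁻ x in S, F x ∂μ ≤ ENNReal.ofReal a)
    (hT : ∫⁻ x in T, F x ∂μ ≤ ENNReal.ofReal b) :
    ∫⁻ x in S ∪ T, F x ∂μ ≤ ENNReal.ofReal (a + b) := by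
  rw [ENNReal.ofReal_add ha hb]
  exact (lintegral_union_le F S T).trans (add_le_add hS hT)

section Error

variable {n : ℕ} [NeZero n] {s α C : ℝ} {Ω : Set (RR n)} {ψ : RR n → ℝ}

theorem IsRegularizedDistance.setLIntegral_ball_linearizationError_le
    (h : IsRegularizedDistance α C Ω ψ) (hα1 : α < 1) (hΩ : IsOpen Ω) (hs : 0 < s) (hs1 : s < 1)
    {x₀ : RR n} (hx₀ : 0 < bdist Ω x₀) :
    ∫⁻ y in ball (0 : RR n) (bdist Ω x₀ / 2),
      ENNReal.ofReal (|linearizationError s ψ x₀ y| * ‖y‖ ^ (-((n : ℝ) + 2 * s))) ≤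
      ENNReal.ofReal (n * volume.real (ball (0 : RR n) 1) / (2 - 2 * s) * C ^ (2 - s) *
        (bdist Ω x₀ / 2) ^ (α - s)) := by
  have hC := h.const_pos
  have hδ : 0 < bdist Ω x₀ / 2 := by linarith
  refine (setLIntegral_ball_kernel_le hs1 hδ
    (A := C ^ (2 - s) * (bdist Ω x₀ / 2) ^ (α + s - 2)) (by positivity) fun y hy =>
    h.abs_linearizationError_le_sq hα1 hΩ hs hs1 hx₀ (by simpa using hy)).trans (le_of_eq ?_)
  congr 1
  have : (bdist Ω x₀ / 2) ^ (α - s) =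
      (bdist Ω x₀ / 2) ^ (α + s - 2) * (bdist Ω x₀ / 2) ^ (2 - 2 * s) := by
    rw [← Real.rpow_add hδ]; congr 1; ring
  rw [this]
  ring

theorem IsRegularizedDistance.setLIntegral_compl_ball_linearizationError_le
    (h : IsRegularizedDistance α C Ω ψ) (hs : 0 < s) {x₀ : RR n} (hx₀ : x₀ ∈ Ω) {η : ℝ}
    (hη : 0 < η) :
    ∫⁻ y in (ball (0 : RR n) η)ᶜ,
      ENNReal.ofReal (|linearizationError s ψ x₀ y| * ‖y‖ ^ (-((n : ℝ) + 2 * s))) ≤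
      ENNReal.ofReal (volume.real (ball (0 : RR n) 1) * ((n + s) / s) * (C * (1 + η⁻¹)) ^ s *
        η ^ (-s)) := by
  have hC := h.const_pos
  exact setLIntegral_compl_ball_kernel_le hs hη (by positivity) fun y hy =>
    h.abs_linearizationError_le_rpow hs hx₀ hη (by simpa using hy)

/-- Contribution of the annuli where the chart of the boundary is used. -/
theorem IsRegularizedDistance.setLIntegral_annulus_linearizationError_le
    (h : IsRegularizedDistance α C Ω ψ) (hα : 0 < α) (hα1 : α < 1) (hΩ : IsOpen Ω) (hs : 0 < s)
    (hs1 : s < 1) (hαs : α < s) {R M : ℝ} (hR : 0 < R) (hR1 : R ≤ 1) (hM : 1 ≤ M) {z e : RR n}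
    (hz : z ∉ Ω) {f : RR n → ℝ} (hc : IsLipschitzChart Ω R M z e f) {x₀ : RR n} (hx₀ : x₀ ∈ Ω)
    (hρ : 0 < bdist Ω x₀) (hx₀z : bdist Ω x₀ = ‖x₀ - z‖) (hρR : bdist Ω x₀ < R / 4)
    (hsmall : 4 * C ^ 2 * bdist Ω x₀ ^ α ≤ 1) {η : ℝ} (hη : 0 < η) :
    ∫⁻ y in (ball (0 : RR n) η)ᶜ ∩ ball 0 (R / (16 * M ^ 2)),
      ENNReal.ofReal (|linearizationError s ψ x₀ y| * ‖y‖ ^ (-((n : ℝ) + 2 * s))) ≤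
      ENNReal.ofReal (500 * M ^ 5 * C ^ 2 * (volume.real (ball (0 : RR n) 1) *
        (((1 + 1) ^ n + (1 + 2 * C) ^ n) / s) * (((n : ℝ) + 2 * s - 1 - α) / (s - α))) *
          η ^ (α - s)) := by
  have hC := h.const_pos
  have hn : (1 : ℝ) ≤ n := by exact_mod_cast Nat.pos_of_neZero n
  have hsα : 0 < s - α := by linarith
  have hβ : 0 < (n : ℝ) + 2 * s - 1 - α := by linarith
  obtain ⟨v, hv, hgv⟩ := h.exists_fderiv_eq_one hα hΩ hx₀ hρ hz hx₀z hsmall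
  have i1 := setLIntegral_compl_ball_max_rpow_mul_le hs hs1 hαs hη (g := fun y => f (x₀ + y))
    (hc.continuous.measurable.comp (measurable_const_add x₀)) (v := e) (m := 1) hc.norm_eq.le
    (fun x τ => by rw [← add_assoc, hc.shift])
  have i2 := setLIntegral_compl_ball_max_rpow_mul_le hs hs1 hαs hη
    (g := fun y => linearization ψ x₀ (x₀ + y))
    ((continuous_linearization ψ x₀).measurable.comp (measurable_const_add x₀)) hv
    (fun x τ => by rw [← add_assoc, linearization_add, map_smul, hgv, smul_eq_mul, mul_one])
  set K := 500 * M ^ 5 * C ^ 2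
  have hK : 0 ≤ K := by positivity
  set k : RR n → ℝ := fun y => ‖y‖ ^ (-((n : ℝ) + 2 * s - 1 - α))
  have hk : Measurable k := by fun_prop
  have hk0 : ∀ y, 0 ≤ k y := fun y => by positivity
  have hlm := (continuous_linearization ψ x₀).measurable
  have hfm := hc.continuous.measurable
  calc _ ≤ ∫⁻ y in (ball (0 : RR n) η)ᶜ ∩ ball 0 (R / (16 * M ^ 2)), ENNReal.ofReal K *
        (ENNReal.ofReal (max (f (x₀ + y)) 0 ^ (s - 1) * k y) +
        ENNReal.ofReal (max (linearization ψ x₀ (x₀ + y)) 0 ^ (s - 1) * k y)) := by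
        refine setLIntegral_mono' (measurableSet_ball.compl.inter measurableSet_ball) fun y hy => ?_
        have hy0 : 0 < ‖y‖ := hη.trans_le (by simpa using hy.1)
        have hk0y := hk0 y
        rw [← ENNReal.ofReal_add (by positivity) (by positivity), ← ENNReal.ofReal_mul hK]
        refine ENNReal.ofReal_le_ofReal ?_
        have hyR : ‖y‖ < R / (16 * M ^ 2) := by simpa using hy.2
        rw [lt_div_iff₀' (by positivity)] at hyR
        have hw := h.abs_linearizationError_le_of_chart hα hα1 hΩ hs hs1 hR hR1 hM hz hc hx₀ hρ
          (by rwa [← hx₀z]) hyR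
        have e1 : k y = ‖y‖ ^ (1 + α) * ‖y‖ ^ (-((n : ℝ) + 2 * s)) := by
          rw [← Real.rpow_add hy0]; simp only [k]; congr 1; ring
        refine (mul_le_mul_of_nonneg_right hw (by positivity)).trans (le_of_eq ?_)
        rw [e1]
        ring
    _ ≤ ∫⁻ y in (ball (0 : RR n) η)ᶜ, ENNReal.ofReal K *
        (ENNReal.ofReal (max (f (x₀ + y)) 0 ^ (s - 1) * k y) +
        ENNReal.ofReal (max (linearization ψ x₀ (x₀ + y)) 0 ^ (s - 1) * k y)) :=
        lintegral_mono_set inter_subset_left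
    _ = ENNReal.ofReal K * (_ + _) := by
        rw [lintegral_const_mul _ (by fun_prop), lintegral_add_left (by fun_prop)]
    _ ≤ ENNReal.ofReal K * (_ + _) := mul_le_mul' le_rfl (add_le_add i1 i2)
    _ = _ := by
        rw [← ENNReal.ofReal_add (by positivity) (by positivity), ← ENNReal.ofReal_mul hK]
        congr 1
        ring

/-- The error of linearizing a regularized distance before taking the power `s` is integrable
against the kernel, uniformly for all regularized distances with a given constant. -/
theorem exists_lintegral_linearizationError_le (hα : 0 < α) (hs1 : s < 1) (hαs : α < s)
    (hΩb : Bornology.IsBounded Ω) (hΩ : IsC1HolderDomain α Ω) (hC : 0 < C) :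
    ∃ B > 0, ∀ ψ : RR n → ℝ, IsRegularizedDistance α C Ω ψ → ∀ x₀ ∈ Ω, 0 < bdist Ω x₀ →
      ∫⁻ y, ENNReal.ofReal (|linearizationError s ψ x₀ y| * ‖y‖ ^ (-((n : ℝ) + 2 * s))) ≤
        ENNReal.ofReal (B * bdist Ω x₀ ^ (α - s)) := by
  have hs : 0 < s := hα.trans hαs
  have hα1 : α < 1 := hαs.trans hs1
  have hn : (1 : ℝ) ≤ n := by exact_mod_cast Nat.pos_of_neZero n
  have hsα : 0 < s - α := by linarith
  have hβ : 0 < (n : ℝ) + 2 * s - 1 - α := by linarith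
  have h2s : 0 < 2 - 2 * s := by linarith
  have hΩo := hΩ.1
  obtain ⟨R, hR, hR1, M, hM, hchart⟩ := exists_lipschitzChart hΩb hΩ
  set V := volume.real (ball (0 : RR n) 1) with hV
  have hV0 : 0 < V :=
    ENNReal.toReal_pos (measure_ball_pos _ _ one_pos).ne' measure_ball_lt_top.ne
  set B₁ := n * V / (2 - 2 * s) * C ^ (2 - s) with hB₁
  set B₂ := 500 * M ^ 5 * C ^ 2 * (V * (((1 + 1) ^ n + (1 + 2 * C) ^ n) / s) *
    (((n : ℝ) + 2 * s - 1 - α) / (s - α))) with hB₂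
  set R' := R / (16 * M ^ 2) with hR'
  set B₃ := V * ((n + s) / s) * (C * (1 + R'⁻¹)) ^ s * R' ^ (-s) with hB₃
  -- Below `ρ₀` both the boundary chart and the nondegeneracy of the gradient are available; above
  -- it the near and far bounds alone suffice.
  set ρ₀ := min (R / 4) ((4 * C ^ 2)⁻¹ ^ α⁻¹) with hρ₀
  have hρ₀pos : 0 < ρ₀ := by positivity
  set B₄ := V * ((n + s) / s) * (C * (1 + (ρ₀ / 2)⁻¹)) ^ s * (ρ₀ / 2) ^ (-α) with hB₄
  have p1 : 0 < B₁ := by positivity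
  have p2 : 0 < B₂ := by positivity
  have p3 : 0 < B₃ := by positivity
  have p4 : 0 < B₄ := by positivity
  refine ⟨(B₁ + B₂ + B₃ + B₄) * 2 ^ (s - α), by positivity, fun ψ h x₀ hx₀ hρ => ?_⟩
  set ρ := bdist Ω x₀ with hρdef
  have hρ2 : 0 < ρ / 2 := by linarith
  have hscale : 2 ^ (s - α) * ρ ^ (α - s) = (ρ / 2) ^ (α - s) := by
    rw [← neg_sub s α, Real.rpow_neg hρ.le, Real.rpow_neg hρ2.le, Real.div_rpow hρ.le zero_le_two,
      inv_div, div_eq_mul_inv]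
  rw [mul_assoc, hscale]
  have hD : 0 < (ρ / 2) ^ (α - s) := by positivity
  have near := h.setLIntegral_ball_linearizationError_le hα1 hΩo hs hs1 hρ
  rw [← hρdef, ← hV, ← hB₁] at near
  rw [← setLIntegral_univ]
  rcases lt_or_ge ρ ρ₀ with hlt | hge
  -- The whole space is excluded because the distance to the empty set is zero by convention.
  · obtain ⟨z, hzf, hxz⟩ := exists_mem_frontier_infDist_compl_eq_dist hx₀ (by
      rintro rfl
      simp [hρdef, bdist] at hρ)
    rw [dist_eq_norm] at hxz
    have hz : z ∉ Ω := by
      rw [hΩo.frontier_eq] at hzf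
      exact hzf.2
    obtain ⟨e, f, hc⟩ := hchart z hzf
    have hρR : ρ < R / 4 := hlt.trans_le (min_le_left _ _)
    have hsmall : 4 * C ^ 2 * ρ ^ α ≤ 1 := by
      have h1 := Real.rpow_le_rpow hρ.le (hlt.le.trans (min_le_right _ _)) hα.le
      rw [← Real.rpow_mul (by positivity), inv_mul_cancel₀ hα.ne', Real.rpow_one] at h1
      calc 4 * C ^ 2 * ρ ^ α ≤ 4 * C ^ 2 * (4 * C ^ 2)⁻¹ := by gcongr
        _ = 1 := mul_inv_cancel₀ (by positivity)
    have mid := h.setLIntegral_annulus_linearizationError_le hα hα1 hΩo hs hs1 hαs hR hR1 hM hz hc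
      hx₀ hρ hxz hρR hsmall hρ2
    rw [← hV, ← hB₂, ← hR'] at mid
    have far := h.setLIntegral_compl_ball_linearizationError_le hs hx₀ (η := R') (by positivity)
    rw [← hV, ← hB₃] at far
    have hcover : (univ : Set (RR n)) ⊆ (ball 0 (ρ / 2) ∪ (ball 0 (ρ / 2))ᶜ ∩ ball 0 R') ∪
        (ball 0 R')ᶜ := by
      intro y _
      by_cases h1 : y ∈ ball (0 : RR n) (ρ / 2) <;> by_cases h2 : y ∈ ball (0 : RR n) R' <;>
        simp only [mem_union, mem_inter_iff, mem_compl_iff, h1, h2] <;> tauto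
    refine (lintegral_mono_set hcover).trans ((setLIntegral_union_le_ofReal (by positivity) p3.le
      (setLIntegral_union_le_ofReal (by positivity) (by positivity) near mid) far).trans
      (ENNReal.ofReal_le_ofReal ?_))
    have hD1 : 1 ≤ (ρ / 2) ^ (α - s) :=
      Real.one_le_rpow_of_pos_of_le_one_of_nonpos hρ2 (by linarith) (by linarith)
    have : B₃ ≤ B₃ * (ρ / 2) ^ (α - s) := le_mul_of_one_le_right p3.le hD1
    have : 0 < B₄ * (ρ / 2) ^ (α - s) := by positivity
    linarith
  · have far := h.setLIntegral_compl_ball_linearizationError_le hs hx₀ hρ2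
    rw [← hV] at far
    have hle : V * ((n + s) / s) * (C * (1 + (ρ / 2)⁻¹)) ^ s * (ρ / 2) ^ (-s) ≤
        B₄ * (ρ / 2) ^ (α - s) := by
      have e1 : (ρ / 2) ^ (-s) = (ρ / 2) ^ (-α) * (ρ / 2) ^ (α - s) := by
        rw [← Real.rpow_add hρ2]; congr 1; ring
      rw [e1, ← mul_assoc]
      have a1 : (ρ / 2) ^ (-α) ≤ (ρ₀ / 2) ^ (-α) :=
        Real.rpow_le_rpow_of_nonpos (by linarith) (by linarith) (by linarith)
      have a2 : (C * (1 + (ρ / 2)⁻¹)) ^ s ≤ (C * (1 + (ρ₀ / 2)⁻¹)) ^ s := by gcongr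
      rw [hB₄]
      exact mul_le_mul_of_nonneg_right (mul_le_mul (mul_le_mul_of_nonneg_left a2 (by positivity)) a1
        (by positivity) (by positivity)) hD.le
    rw [← union_compl_self (ball (0 : RR n) (ρ / 2))]
    refine (setLIntegral_union_le_ofReal (by positivity) (by positivity) near far).trans
      (ENNReal.ofReal_le_ofReal ?_)
    have : 0 < (B₂ + B₃) * (ρ / 2) ^ (α - s) := by positivity
    linarith

end Error

/-! ### Decomposition of the integrand and conclusion. -/

theorem bdist_pos {n : ℕ} [NeZero n] {Ω : Set (RR n)} (hΩb : Bornology.IsBounded Ω)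
    (hΩ : IsOpen Ω) {x : RR n} (hx : x ∈ Ω) : 0 < bdist Ω x := by
  have hne : Ωᶜ.Nonempty := by
    rw [nonempty_compl]
    rintro rfl
    exact NormedSpace.unbounded_univ ℝ (RR n) hΩb
  exact (hΩ.isClosed_compl.notMem_iff_infDist_pos hne).1 (by simpa using hx)

/-- Since `ℓ(x₀) = ψ x₀ > 0`, factoring out `ψ x₀ ^ s` normalizes the second difference of `ℓ₊ ^ s`
to the one-dimensional profile along the gradient divided by `ψ x₀`. -/
theorem IsRegularizedDistance.opIntegrand_eq {n : ℕ} {α C s : ℝ} {Ω : Set (RR n)}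
    {ψ : RR n → ℝ} (h : IsRegularizedDistance α C Ω ψ) (a : RR n → ℝ) {x₀ : RR n}
    (hρ : 0 < bdist Ω x₀) (y : RR n) :
    opIntegrand s a (fun z => ψ z ^ s) x₀ y =
      1 / 2 * (linearizationError s ψ x₀ y * (a (‖y‖⁻¹ • y) / ‖y‖ ^ ((n : ℝ) + 2 * s)) +
        linearizationError s ψ x₀ (-y) * (a (‖y‖⁻¹ • y) / ‖y‖ ^ ((n : ℝ) + 2 * s)) +
        ψ x₀ ^ s * (powSecondDiff s (((ψ x₀)⁻¹ • fderiv ℝ ψ x₀) y) *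
          (a (‖y‖⁻¹ • y) / ‖y‖ ^ ((n : ℝ) + 2 * s)))) := by
  have hC := h.const_pos
  have hb : 0 < ψ x₀ := (show 0 < C⁻¹ * bdist Ω x₀ by positivity).trans_le (h.lower x₀)
  have key : ∀ t : ℝ, max (ψ x₀ + t) 0 ^ s = ψ x₀ ^ s * max (1 + (ψ x₀)⁻¹ * t) 0 ^ s := by
    intro t
    rw [← Real.mul_rpow hb.le (le_max_right _ _), mul_max_of_nonneg _ _ hb.le, mul_zero, mul_add,
      mul_one, mul_inv_cancel_left₀ hb.ne']
  have e1 : x₀ - y = x₀ + -y := sub_eq_add_neg _ _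
  have e2 : ∀ t : ℝ, 1 - t = 1 + -t := sub_eq_add_neg 1
  simp only [opIntegrand, linearizationError, powSecondDiff, linearization, e1, e2,
    add_sub_cancel_left, key, map_neg, _root_.smul_apply, smul_eq_mul, mul_neg]
  ring

end StableBarrier

theorem proposition2p2 (n : ℕ) (hn : 1 ≤ n) (s α lam Lam C₀ : ℝ)
    (hs : 0 < s) (hs1 : s < 1) (hα : 0 < α) (hαs : α < s) (hlam : 0 < lam)
    (Ω : Set (StableBarrier.RR n)) (hΩb : Bornology.IsBounded Ω)
    (hΩ : StableBarrier.IsC1HolderDomain α Ω) :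
    ∃ C > 0, ∀ a : StableBarrier.RR n → ℝ, StableBarrier.IsEllipticDensity lam Lam a →
      ∀ ψ : StableBarrier.RR n → ℝ, StableBarrier.IsRegularizedDistance α C₀ Ω ψ →
        ∀ x ∈ Ω,
          Integrable (StableBarrier.opIntegrand s a (fun z => ψ z ^ s) x) ∧
          |StableBarrier.op s a (fun z => ψ z ^ s) x| ≤ C * StableBarrier.bdist Ω x ^ (α - s) := by
  have : NeZero n := ⟨by omega⟩
  rcases le_or_gt C₀ 0 with hC | hC
  · exact ⟨1, one_pos, fun a _ ψ h => absurd h.const_pos hC.not_gt⟩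
  obtain ⟨B, hB, hbound⟩ := StableBarrier.exists_lintegral_linearizationError_le hα hs1 hαs hΩb
    hΩ hC
  refine ⟨|Lam| * B + 1, by positivity, fun a ha ψ h x hx => ?_⟩
  have hρ := StableBarrier.bdist_pos hΩb hΩ.1 hx
  have hw := hbound ψ h x hx hρ
  have hm := h.measurable_linearizationError hΩ.1 s x
  have hBρ : 0 ≤ B * StableBarrier.bdist Ω x ^ (α - s) := by positivity
  obtain ⟨i1, b1⟩ := ha.integrable_mul_kernel hlam hm hBρ hw
  -- The density need not be even, so the error at `-y` is treated separately; the bound in `hw`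
  -- contains no density and is invariant under reflection.
  obtain ⟨i2, b2⟩ := ha.integrable_mul_kernel hlam
    (w := fun y => StableBarrier.linearizationError s ψ x (-y)) (hm.comp measurable_neg) hBρ (by
      rw [← lintegral_neg_eq_self] at hw
      simpa only [norm_neg] using hw)
  obtain ⟨i3, b3⟩ := ha.integral_powSecondDiff_mul_kernel hlam hs hs1
    ((ψ x)⁻¹ • fderiv ℝ ψ x)
  have heq : StableBarrier.opIntegrand s a (fun z => ψ z ^ s) x = _ :=
    funext fun y => h.opIntegrand_eq a hρ y
  rw [StableBarrier.op, heq]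
  refine ⟨((i1.add i2).add (i3.const_mul _)).const_mul _, ?_⟩
  have e := integral_add (i1.add i2) (i3.const_mul (ψ x ^ s))
  simp only [Pi.add_apply] at e
  rw [integral_const_mul, e, integral_add i1 i2, integral_const_mul, b3, mul_zero, add_zero, abs_mul,
    abs_of_pos (by norm_num : (0 : ℝ) < 1 / 2)]
  have h3 := (abs_add_le _ _).trans (add_le_add b1 b2)
  have h4 : 0 ≤ StableBarrier.bdist Ω x ^ (α - s) := by positivity
  linarith
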